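/- Let $k$ be an algebraically closed field of characteristic zero (for example $k=\mathbb C$), let $r\ge 0$ be an integer and let $V=k((z_1))\times\dots\times k((z_r))$. For a $k$-scheme $S$ put $R=H^0(S,\mathcal O_S)$ and let $V\widehat\otimes_k R=R((z_1))\times\dots\times R((z_r))$, with the linear topology in which the submodules $z^nR[[z_1]]\times\dots\times z^nR[[z_r]]$ $(n\in\mathbb Z)$ form a basis of neighbourhoods of $0$. Let $\underline{\mathrm{Aut}}_k(V)(S)$ be the group of bicontinuous $R$-algebra automorphisms of $V\widehat\otimes_k R$; with base change of automorphisms along $H^0(S,\mathcal O_S)\to H^0(T,\mathcal O_T)$ for $T\to S$ this is a contravariant functor from $k$-schemes to groups. Let $G=\underline{\mathrm{Aut}}_k(k((z)))$ be the case $r=1$, let $i\colon G^r\to\underline{\mathrm{Aut}}_k(V)$ be the canonical inclusion, acting factor by factor, and let $\mathcal S_r$ be the constant group scheme over $k$ with group the symmetric group on $r$ letters, so that $\mathcal S_r(S)$ is the group of locally constant functions from $S$ to the symmetric group. Then there is a (necessarily unique) morphism of group functors $p\colon\underline{\mathrm{Aut}}_k(V)\to\mathcal S_r$ which records the permutation of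 the factors of $V$: for every $k$-scheme $S$, every $\phi\in\underline{\mathrm{Aut}}_k(V)(S)$, every $s\in S$ with residue field $k(s)$ and every index $i$, the value $\phi(s)\in\mathrm{Aut}_{k(s)}(V\widehat\otimes_k k(s))$ satisfies $\phi(s)(I_i)=I_{p(\phi)(s)(i)}$, where $I_i\subset V\widehat\otimes_k k(s)$ is the ideal generated by $(0,\dots,0,z_i,0,\dots,0)$. For this $p$ the sequence of functors in groups $$0\to G\times\overset{r}{\cdots}\times G\xrightarrow{\ i\ }\underline{\mathrm{Aut}}_k(V)\xrightarrow{\ p\ }\mathcal S_r\to 0$$ is exact when evaluated at every $k$-scheme $S$, and it splits: there is a morphism of group functors $t\colon\mathcal S_r\to\underline{\mathrm{Aut}}_k(V)$ with $p\circ t=\mathrm{id}$. Moreover, $\underline{\mathrm{Aut}}_k(V)$ is representable by a formal group $k$-scheme $G_V$: there is a directed system of $k$-schemes $(X_j)_j$, all of whose transition maps are closed immersions with nilpotent ideal, such that the functor of sets underlying $\underline{\mathrm{Aut}}_k(V)$ is the direct limit $\varinjlim_j\mathrm{Hom}_k(-,X_j)$ as a functor on all $k$-schemes. -/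

import Mathlib

open CategoryTheory CategoryTheory.Limits AlgebraicGeometry Opposite
open scoped LaurentSeries Topology

universe u

namespace Virasoro

noncomputable section

/-- The algebra of Laurent series over its ring of coefficients, with the structure map given by
constant series; the scalar multiplication is coefficientwise. -/
instance (priority := high) coeffAlgebra (R : Type u) [CommRing R] : Algebra R R⸨X⸩ :=
  HahnSeries.instAlgebra

/-- The completed tensor product of `k((z_1)) × ⋯ × k((z_r))` with a `k`-algebra `R`, that is, the
`R`-algebra `R((z_1)) × ⋯ × R((z_r))` with componentwise operations. -/
abbrev V (r : ℕ) (R : Type u) [CommRing R] : Type u := Fin r → R⸨X⸩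

section Topology

variable (r : ℕ) (R : Type u) [CommRing R]

/-- The `R`-submodule `z^n R[[z_1]] × ⋯ × z^n R[[z_r]]` of `V r R`. -/
def lattice (n : ℤ) : Submodule R (V r R) where
  carrier := {v | ∀ i, ∀ m < n, (v i).coeff m = 0}
  add_mem' := by
    intro a b ha hb i m hm
    simp [ha i m hm, hb i m hm]
  zero_mem' := by
    intro i m _
    simp
  smul_mem' := by
    intro c v hv i m hm
    simp [hv i m hm]

/-- The linear topology on `V r R` in which the submodules `lattice r R n` are a basis of
neighbourhoods of zero. -/
@[reducible] def zTopology : TopologicalSpace (V r R) where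
  IsOpen U := ∀ v ∈ U, ∃ n : ℤ, ∀ w, w - v ∈ lattice r R n → w ∈ U
  isOpen_univ := fun _ _ => ⟨0, fun _ _ => trivial⟩
  isOpen_inter := by
    intro U U' hU hU' v hv
    obtain ⟨n, hn⟩ := hU v hv.1
    obtain ⟨n', hn'⟩ := hU' v hv.2
    refine ⟨max n n', fun w hw => ⟨hn w ?_, hn' w ?_⟩⟩
    · intro i m hm
      exact hw i m (lt_of_lt_of_le hm (le_max_left _ _))
    · intro i m hm
      exact hw i m (lt_of_lt_of_le hm (le_max_right _ _))
  isOpen_sUnion := by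
    intro s hs v hv
    obtain ⟨U, hU, hvU⟩ := hv
    obtain ⟨n, hn⟩ := hs U hU v hvU
    exact ⟨n, fun w hw => ⟨U, hU, hn w hw⟩⟩

/-- The group of continuous `R`-algebra automorphisms of `V r R` (with continuous inverse). -/
def contAut : Subgroup (V r R ≃ₐ[R] V r R) where
  carrier := {φ | Continuous[zTopology r R, zTopology r R] φ ∧
    Continuous[zTopology r R, zTopology r R] φ.symm}
  mul_mem' := by
    intro a b ha hb
    let _ := zTopology r R
    exact ⟨ha.1.comp hb.1, hb.2.comp ha.2⟩
  one_mem' := by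
    let _ := zTopology r R
    exact ⟨continuous_id, continuous_id⟩
  inv_mem' := by
    intro a ha
    exact ⟨ha.2, ha.1⟩

end Topology

section Continuity

variable {r r' : ℕ} {R : Type u} [CommRing R] {R' : Type u} [CommRing R']

theorem lattice_antitone {n m : ℤ} (h : n ≤ m) {v : V r R} (hv : v ∈ lattice r R m) :
    v ∈ lattice r R n :=
  fun i l hl => hv i l (lt_of_lt_of_le hl h)

/-- Continuity at zero, in terms of the filtration by lattices. -/
def LatCont (φ : V r R →+ V r' R') : Prop :=
  ∀ n : ℤ, ∃ m : ℤ, ∀ v ∈ lattice r R m, φ v ∈ lattice r' R' n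

theorem continuous_iff_latCont (φ : V r R →+ V r' R') :
    Continuous[zTopology r R, zTopology r' R'] φ ↔ LatCont φ := by
  let _ := zTopology r R
  let _ := zTopology r' R'
  constructor
  · intro h n
    have ho : IsOpen (lattice r' R' n : Set (V r' R')) := by
      intro v hv
      exact ⟨n, fun w hw => by simpa using (lattice r' R' n).add_mem hw hv⟩
    have h0 : (0 : V r R) ∈ φ ⁻¹' (lattice r' R' n : Set (V r' R')) := by simp
    obtain ⟨m, hm⟩ := (ho.preimage h) 0 h0
    exact ⟨m, fun v hv => hm v (by simpa using hv)⟩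
  · intro h
    refine continuous_def.2 fun U hU v hv => ?_
    obtain ⟨n, hn⟩ := hU (φ v) hv
    obtain ⟨m, hm⟩ := h n
    exact ⟨m, fun w hw => hn (φ w) (by simpa using hm _ hw)⟩

/-- The element of `V r R` with `c z^n` in the factor `i` and zero elsewhere. -/
def mono (i : Fin r) (n : ℤ) (c : R) : V r R := Pi.single i (HahnSeries.single n c)

theorem mono_apply_coeff (i j : Fin r) (n m : ℤ) (c : R) :
    (mono i n c j).coeff m = if j = i ∧ m = n then c else 0 := by
  classical
  by_cases h : j = i
  · subst h
    simp [mono, HahnSeries.coeff_single]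
  · simp [mono, h]

theorem mono_mem_lattice (i : Fin r) {n m : ℤ} (h : n ≤ m) (c : R) :
    mono i m c ∈ lattice r R n := by
  intro j l hl
  rw [mono_apply_coeff, if_neg]
  rintro ⟨-, rfl⟩
  omega

theorem smul_mono (i : Fin r) (n : ℤ) (a c : R) : a • mono i n c = mono i n (a * c) := by
  funext j
  ext m
  simp [mono_apply_coeff]

theorem mono_mul_mono (i : Fin r) (n m : ℤ) (a c : R) :
    mono i n a * mono i m c = mono i (n + m) (a * c) := by
  rw [mono, mono, ← Pi.single_mul, HahnSeries.single_mul_single, mono]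

theorem mono_mul_mono_of_ne {i j : Fin r} (h : i ≠ j) (n m : ℤ) (a c : R) :
    mono i n a * mono j m c = 0 := by
  funext l
  by_cases hl : l = i
  · subst hl
    simp [mono, h]
  · simp [mono, hl]

theorem exists_mem_lattice (v : V r R) : ∃ n, v ∈ lattice r R n := by
  by_cases hr : r = 0
  · subst hr
    exact ⟨0, fun i => i.elim0⟩
  · refine ⟨Finset.univ.inf' ⟨⟨0, Nat.pos_of_ne_zero hr⟩, Finset.mem_univ _⟩
      fun i => (v i).order, fun i m hm => HahnSeries.coeff_eq_zero_of_lt_order ?_⟩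
    exact lt_of_lt_of_le hm (Finset.inf'_le _ (Finset.mem_univ i))

/-- Finite sums of monomials are dense. -/
theorem exists_sum_mono (v : V r R) (N : ℤ) :
    ∃ L : ℤ, v - ∑ i, ∑ n ∈ Finset.Ico L N, mono i n ((v i).coeff n) ∈ lattice r R N := by
  obtain ⟨L, hL⟩ := exists_mem_lattice v
  refine ⟨L, fun j m hm => ?_⟩
  have key : ((∑ i, ∑ n ∈ Finset.Ico L N, mono i n ((v i).coeff n)) j).coeff m
      = if L ≤ m then (v j).coeff m else 0 := by
    simp only [Finset.sum_apply, HahnSeries.coeff_sum, mono_apply_coeff]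
    rw [Finset.sum_eq_single j]
    · by_cases h : L ≤ m
      · rw [if_pos h, Finset.sum_eq_single m]
        · simp
        · intro n _ hn
          simp [hn.symm]
        · intro hn
          exact absurd (Finset.mem_Ico.2 ⟨h, hm⟩) hn
      · rw [if_neg h]
        refine Finset.sum_eq_zero fun n hn => if_neg ?_
        rintro ⟨-, rfl⟩
        exact h (Finset.mem_Ico.1 hn).1
    · intro i _ hi
      exact Finset.sum_eq_zero fun n _ => if_neg fun h => hi h.1.symm
    · simp
  rw [Pi.sub_apply, HahnSeries.coeff_sub, key]
  split_ifs with h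
  · simp
  · simp [hL j m (not_le.1 h)]

theorem LatCont.ext {A B : V r R →+ V r' R'} (hA : LatCont A) (hB : LatCont B)
    (h : ∀ i n c, A (mono i n c) = B (mono i n c)) : A = B := by
  refine AddMonoidHom.ext fun v => ?_
  funext j
  ext m
  obtain ⟨M, hM⟩ := hA (m + 1)
  obtain ⟨M', hM'⟩ := hB (m + 1)
  obtain ⟨L, hL⟩ := exists_sum_mono v (max M M')
  set t := ∑ i, ∑ n ∈ Finset.Ico L (max M M'), mono i n ((v i).coeff n) with ht
  have hAB : A t = B t := by simp [ht, h]
  have h1 := hM _ (lattice_antitone (le_max_left _ _) hL) j m (by omega)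
  have h2 := hM' _ (lattice_antitone (le_max_right _ _) hL) j m (by omega)
  rw [map_sub, Pi.sub_apply, HahnSeries.coeff_sub, sub_eq_zero] at h1 h2
  rw [h1, h2, hAB]

theorem LatCont.comp {r'' : ℕ} {R'' : Type u} [CommRing R''] {B : V r' R' →+ V r'' R''}
    {A : V r R →+ V r' R'} (hB : LatCont B) (hA : LatCont A) : LatCont (B.comp A) := by
  intro n
  obtain ⟨m, hm⟩ := hB n
  obtain ⟨l, hl⟩ := hA m
  exact ⟨l, fun v hv => hm _ (hl v hv)⟩

theorem latCont_mulLeft (w : V r R) : LatCont (AddMonoidHom.mulLeft w) := by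
  intro n
  obtain ⟨L, hL⟩ := exists_mem_lattice w
  refine ⟨n - L, fun v hv i m hm => ?_⟩
  rw [AddMonoidHom.coe_mulLeft, Pi.mul_apply, HahnSeries.coeff_mul]
  refine Finset.sum_eq_zero fun p hp => ?_
  have hp2 := (Finset.mem_antidiagonal.1 hp).2.2
  by_cases h : p.1 < L
  · rw [hL i _ h, zero_mul]
  · rw [hv i p.2 (by omega), mul_zero]

theorem latCont_mulRight (w : V r R) : LatCont (AddMonoidHom.mulRight w) := by
  have h := latCont_mulLeft w
  intro n
  obtain ⟨m, hm⟩ := h n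
  exact ⟨m, fun v hv => by simpa [mul_comm] using hm v hv⟩

end Continuity

section BaseChange

variable {r r' : ℕ} {R : Type u} [CommRing R] {R' : Type u} [CommRing R']

/-- The map `V r R → V r R'` which applies `f : R → R'` to all coefficients. -/
def coeffMap (r : ℕ) (f : R →+* R') : V r R →+* V r R' where
  toFun v i := (v i).map f
  map_one' := by
    funext i
    exact HahnSeries.map_one f.toMonoidWithZeroHom
  map_mul' v w := by
    funext i
    exact HahnSeries.map_mul (f : R →ₙ+* R')
  map_zero' := by
    funext i
    ext m
    simp
  map_add' v w := by
    funext i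
    ext m
    simp

theorem coeffMap_coeff (f : R →+* R') (v : V r R) (i : Fin r) (m : ℤ) :
    (coeffMap r f v i).coeff m = f ((v i).coeff m) := rfl

theorem coeffMap_mono (f : R →+* R') (i : Fin r) (n : ℤ) (c : R) :
    coeffMap r f (mono i n c) = mono i n (f c) := by
  funext j
  ext m
  rw [coeffMap_coeff, mono_apply_coeff, mono_apply_coeff]
  split_ifs <;> simp

theorem latCont_coeffMap (f : R →+* R') : LatCont (coeffMap r f).toAddMonoidHom := by
  intro n
  refine ⟨n, fun v hv i m hm => ?_⟩
  change f ((v i).coeff m) = 0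
  rw [hv i m hm, map_zero]

theorem latCont_of_mem (φ : V r R →ₐ[R] V r R) (hφ : Continuous[zTopology r R, zTopology r R] φ) :
    LatCont (φ : V r R →+ V r R) :=
  (continuous_iff_latCont (φ : V r R →+ V r R)).1 hφ

/-- The terms of the series which defines the base change of `φ`. -/
def bcTerm (f : R →+* R') (φ : V r R →ₐ[R] V r R) (v : V r R') (j : Fin r) (m : ℤ) (i : Fin r)
    (n : ℤ) : R' :=
  (v i).coeff n * f ((φ (mono i n 1) j).coeff m)

theorem bcTerm_finite (f : R →+* R') (φ : V r R →ₐ[R] V r R) (hφ : LatCont (φ : V r R →+ V r R))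
    (v : V r R') (j : Fin r) (m : ℤ) (i : Fin r) :
    (Function.support (bcTerm f φ v j m i)).Finite := by
  obtain ⟨M, hM⟩ := hφ (m + 1)
  obtain ⟨L, hL⟩ := exists_mem_lattice v
  refine (Set.finite_Ico L M).subset fun n hn => ?_
  by_contra hnot
  apply hn
  rw [bcTerm]
  by_cases h : n < L
  · rw [hL i n h, zero_mul]
  · have hMn : M ≤ n := by
      by_contra h'
      exact hnot ⟨not_lt.1 h, not_le.1 h'⟩
    have := hM _ (mono_mem_lattice i hMn 1) j m (by omega)
    rw [show (φ (mono i n 1) j).coeff m = 0 from this, map_zero, mul_zero]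

theorem exists_mono_mem (φ : V r R →ₐ[R] V r R) (hφ : LatCont (φ : V r R →+ V r R)) (L : ℤ) :
    ∃ N : ℤ, ∀ i : Fin r, ∀ n, L ≤ n → φ (mono i n 1) ∈ lattice r R N := by
  classical
  obtain ⟨M, hM⟩ := hφ 0
  choose g hg using fun p : Fin r × ℤ => exists_mem_lattice (φ (mono p.1 p.2 1))
  obtain ⟨N, hN⟩ := Finset.exists_le (α := ℤᵒᵈ)
    (insert 0 ((Finset.univ ×ˢ Finset.Ico L M).image g))
  refine ⟨N, fun i n hn => ?_⟩
  by_cases h : n < M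
  · refine lattice_antitone (hN _ (Finset.mem_insert_of_mem (Finset.mem_image_of_mem g ?_)))
      (hg (i, n))
    simp [hn, h]
  · exact lattice_antitone (hN _ (Finset.mem_insert_self _ _))
      (hM _ (mono_mem_lattice i (not_lt.1 h) 1))

theorem bc_bddBelow (f : R →+* R') (φ : V r R →ₐ[R] V r R) (hφ : LatCont (φ : V r R →+ V r R))
    (v : V r R') (j : Fin r) :
    BddBelow (Function.support fun m => ∑ i, ∑ᶠ n, bcTerm f φ v j m i n) := by
  obtain ⟨L, hL⟩ := exists_mem_lattice v
  obtain ⟨N, hN⟩ := exists_mono_mem φ hφ L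
  refine ⟨N, fun m hmem => not_lt.1 fun hm => hmem ?_⟩
  refine Finset.sum_eq_zero fun i _ => finsum_eq_zero_of_forall_eq_zero fun n => ?_
  rw [bcTerm]
  by_cases h : n < L
  · rw [hL i n h, zero_mul]
  · rw [hN i n (not_lt.1 h) j m hm, map_zero, mul_zero]

/-- The base change of a continuous endomorphism `φ` along `f : R → R'`, as an additive map: it
sends `∑ a_{i,n} z_i ^ n` to `∑ a_{i,n} f (φ (z_i ^ n))`. -/
def bcAdd (f : R →+* R') (φ : V r R →ₐ[R] V r R) (hφ : LatCont (φ : V r R →+ V r R)) :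
    V r R' →+ V r R' where
  toFun v j := HahnSeries.ofSuppBddBelow (fun m => ∑ i, ∑ᶠ n, bcTerm f φ v j m i n)
    (bc_bddBelow f φ hφ v j)
  map_zero' := by
    funext j
    ext m
    simp [bcTerm]
  map_add' v w := by
    funext j
    ext m
    simp only [HahnSeries.coeff_ofSuppBddBelow, Pi.add_apply, HahnSeries.coeff_add]
    rw [← Finset.sum_add_distrib]
    refine Finset.sum_congr rfl fun i _ => ?_
    rw [← finsum_add_distrib (bcTerm_finite f φ hφ v j m i) (bcTerm_finite f φ hφ w j m i)]
    refine finsum_congr fun n => ?_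
    simp [bcTerm, add_mul]

theorem bcAdd_coeff (f : R →+* R') (φ : V r R →ₐ[R] V r R) (hφ : LatCont (φ : V r R →+ V r R))
    (v : V r R') (j : Fin r) (m : ℤ) :
    (bcAdd f φ hφ v j).coeff m = ∑ i, ∑ᶠ n, bcTerm f φ v j m i n := rfl

theorem latCont_bcAdd (f : R →+* R') (φ : V r R →ₐ[R] V r R)
    (hφ : LatCont (φ : V r R →+ V r R)) : LatCont (bcAdd f φ hφ) := by
  intro N
  obtain ⟨M, hM⟩ := hφ N
  refine ⟨M, fun v hv j m hm => ?_⟩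
  rw [bcAdd_coeff]
  refine Finset.sum_eq_zero fun i _ => finsum_eq_zero_of_forall_eq_zero fun n => ?_
  rw [bcTerm]
  by_cases h : n < M
  · rw [hv i n h, zero_mul]
  · have := hM _ (mono_mem_lattice i (not_lt.1 h) 1) j m hm
    rw [show (φ (mono i n 1) j).coeff m = 0 from this, map_zero, mul_zero]

theorem bcAdd_mono (f : R →+* R') (φ : V r R →ₐ[R] V r R) (hφ : LatCont (φ : V r R →+ V r R))
    (i : Fin r) (n : ℤ) (c : R') :
    bcAdd f φ hφ (mono i n c) = c • coeffMap r f (φ (mono i n 1)) := by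
  funext j
  ext m
  rw [bcAdd_coeff, Finset.sum_eq_single i, finsum_eq_single _ n]
  · simp [bcTerm, mono_apply_coeff, coeffMap_coeff]
  · intro l hl
    simp [bcTerm, mono_apply_coeff, hl]
  · intro l _ hl
    refine finsum_eq_zero_of_forall_eq_zero fun n => ?_
    simp [bcTerm, mono_apply_coeff, hl]
  · simp

theorem bcAdd_coeffMap (f : R →+* R') (φ : V r R →ₐ[R] V r R)
    (hφ : LatCont (φ : V r R →+ V r R)) (v : V r R) :
    bcAdd f φ hφ (coeffMap r f v) = coeffMap r f (φ v) := by
  have h : (bcAdd f φ hφ).comp (coeffMap r f).toAddMonoidHom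
      = (coeffMap r f).toAddMonoidHom.comp (φ : V r R →+ V r R) := by
    refine LatCont.ext ((latCont_bcAdd f φ hφ).comp (latCont_coeffMap f))
      ((latCont_coeffMap f).comp hφ) fun i n c => ?_
    change bcAdd f φ hφ (coeffMap r f (mono i n c)) = coeffMap r f (φ (mono i n c))
    rw [coeffMap_mono, bcAdd_mono]
    have : mono i n c = c • mono i n (1 : R) := by rw [smul_mono, mul_one]
    rw [this, map_smul]
    funext j
    ext m
    simp [coeffMap_coeff]
  exact DFunLike.congr_fun h v

theorem bcAdd_smul (f : R →+* R') (φ : V r R →ₐ[R] V r R) (hφ : LatCont (φ : V r R →+ V r R))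
    (c : R') (v : V r R') : bcAdd f φ hφ (c • v) = c • bcAdd f φ hφ v := by
  funext j
  ext m
  simp only [Pi.smul_apply, HahnSeries.coeff_smul, bcAdd_coeff, Finset.smul_sum]
  refine Finset.sum_congr rfl fun i _ => ?_
  rw [smul_finsum' _ (bcTerm_finite f φ hφ v j m i)]
  refine finsum_congr fun n => ?_
  simp [bcTerm, mul_assoc]

theorem bcAdd_one (f : R →+* R') (φ : V r R →ₐ[R] V r R) (hφ : LatCont (φ : V r R →+ V r R)) :
    bcAdd f φ hφ 1 = 1 := by
  have h := bcAdd_coeffMap f φ hφ 1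
  rw [map_one φ, (coeffMap r f).map_one] at h
  exact h

theorem bcAdd_mul_mono (f : R →+* R') (φ : V r R →ₐ[R] V r R)
    (hφ : LatCont (φ : V r R →+ V r R)) (i j : Fin r) (n m : ℤ) (a c : R') :
    bcAdd f φ hφ (mono i n a * mono j m c)
      = bcAdd f φ hφ (mono i n a) * bcAdd f φ hφ (mono j m c) := by
  rw [bcAdd_mono, bcAdd_mono, smul_mul_smul_comm, ← map_mul, ← map_mul]
  by_cases h : i = j
  · subst h
    rw [mono_mul_mono, bcAdd_mono, mono_mul_mono, mul_one]
  · rw [mono_mul_mono_of_ne h, mono_mul_mono_of_ne h, map_zero, map_zero, map_zero, smul_zero]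

theorem bcAdd_mul (f : R →+* R') (φ : V r R →ₐ[R] V r R) (hφ : LatCont (φ : V r R →+ V r R))
    (v w : V r R') : bcAdd f φ hφ (v * w) = bcAdd f φ hφ v * bcAdd f φ hφ w := by
  have hB := latCont_bcAdd f φ hφ
  have h1 : ∀ i n c, bcAdd f φ hφ (mono i n c * w)
      = bcAdd f φ hφ (mono i n c) * bcAdd f φ hφ w := by
    intro i n c
    refine DFunLike.congr_fun (LatCont.ext (A := (bcAdd f φ hφ).comp
      (AddMonoidHom.mulLeft (mono i n c))) (B := (AddMonoidHom.mulLeft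
      (bcAdd f φ hφ (mono i n c))).comp (bcAdd f φ hφ)) (hB.comp (latCont_mulLeft _))
      ((latCont_mulLeft _).comp hB) fun j m d => ?_) w
    exact bcAdd_mul_mono f φ hφ i j n m c d
  refine DFunLike.congr_fun (LatCont.ext (A := (bcAdd f φ hφ).comp
    (AddMonoidHom.mulRight w)) (B := (AddMonoidHom.mulRight
    (bcAdd f φ hφ w)).comp (bcAdd f φ hφ)) (hB.comp (latCont_mulRight _))
    ((latCont_mulRight _).comp hB) fun j m d => ?_) v
  exact h1 j m d

/-- The base change `φ ⊗ R'` of a continuous `R`-algebra endomorphism of `V r R`: the unique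
continuous `R'`-algebra endomorphism of `V r R'` which is compatible with `φ`. -/
def bcHom (f : R →+* R') (φ : V r R →ₐ[R] V r R) (hφ : LatCont (φ : V r R →+ V r R)) :
    V r R' →ₐ[R'] V r R' where
  toFun := bcAdd f φ hφ
  map_one' := bcAdd_one f φ hφ
  map_mul' := bcAdd_mul f φ hφ
  map_zero' := map_zero _
  map_add' := map_add _
  commutes' c := by
    rw [Algebra.algebraMap_eq_smul_one, bcAdd_smul, bcAdd_one]

theorem latCont_bcHom (f : R →+* R') (φ : V r R →ₐ[R] V r R)
    (hφ : LatCont (φ : V r R →+ V r R)) : LatCont (bcHom f φ hφ : V r R' →+ V r R') :=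
  latCont_bcAdd f φ hφ

theorem bcHom_coeffMap (f : R →+* R') (φ : V r R →ₐ[R] V r R)
    (hφ : LatCont (φ : V r R →+ V r R)) (v : V r R) :
    bcHom f φ hφ (coeffMap r f v) = coeffMap r f (φ v) :=
  bcAdd_coeffMap f φ hφ v

/-- A continuous `R'`-algebra endomorphism is determined by its values on Laurent series with
coefficients in the image of `R`. -/
theorem algHom_ext_of_coeffMap (f : R →+* R') {A B : V r R' →ₐ[R'] V r R'}
    (hA : LatCont (A : V r R' →+ V r R')) (hB : LatCont (B : V r R' →+ V r R'))
    (h : ∀ v, A (coeffMap r f v) = B (coeffMap r f v)) : A = B := by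
  refine AlgHom.ext fun v => DFunLike.congr_fun (LatCont.ext hA hB fun i n c => ?_) v
  change A (mono i n c) = B (mono i n c)
  have hc : mono i n c = c • coeffMap r f (mono i n 1) := by
    rw [coeffMap_mono, map_one, smul_mono, mul_one]
  rw [hc, map_smul, map_smul, h]

theorem latCont (φ : contAut r R) :
    LatCont ((φ.1 : V r R →ₐ[R] V r R) : V r R →+ V r R) :=
  (continuous_iff_latCont ((φ.1 : V r R →ₐ[R] V r R) : V r R →+ V r R)).1 φ.2.1

theorem latCont_symm (φ : contAut r R) :
    LatCont ((φ.1.symm : V r R →ₐ[R] V r R) : V r R →+ V r R) :=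
  (continuous_iff_latCont ((φ.1.symm : V r R →ₐ[R] V r R) : V r R →+ V r R)).1 φ.2.2

theorem bcHom_bcHom (f : R →+* R') {φ ψ : V r R →ₐ[R] V r R} (hφ : LatCont (φ : V r R →+ V r R))
    (hψ : LatCont (ψ : V r R →+ V r R)) (h : ∀ v, φ (ψ v) = v) (v : V r R') :
    bcHom f φ hφ (bcHom f ψ hψ v) = v := by
  have h1 : LatCont (((bcHom f φ hφ).comp (bcHom f ψ hψ) : V r R' →ₐ[R'] V r R') :
      V r R' →+ V r R') := (latCont_bcHom f φ hφ).comp (latCont_bcHom f ψ hψ)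
  have h2 : LatCont ((AlgHom.id R' (V r R') : V r R' →ₐ[R'] V r R') : V r R' →+ V r R') :=
    fun n => ⟨n, fun _ hv => hv⟩
  refine DFunLike.congr_fun (algHom_ext_of_coeffMap f h1 h2 fun w => ?_) v
  rw [AlgHom.comp_apply, bcHom_coeffMap, bcHom_coeffMap, h, AlgHom.id_apply]

/-- The base change of a continuous automorphism. -/
def bcEquiv (f : R →+* R') (φ : contAut r R) : V r R' ≃ₐ[R'] V r R' :=
  { bcHom f (φ.1 : V r R →ₐ[R] V r R) (latCont φ) with
    invFun := bcHom f (φ.1.symm : V r R →ₐ[R] V r R) (latCont_symm φ)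
    left_inv := bcHom_bcHom f (latCont_symm φ) (latCont φ) φ.1.symm_apply_apply
    right_inv := bcHom_bcHom f (latCont φ) (latCont_symm φ) φ.1.apply_symm_apply }

theorem bcEquiv_coeffMap (f : R →+* R') (φ : contAut r R) (v : V r R) :
    bcEquiv f φ (coeffMap r f v) = coeffMap r f (φ.1 v) :=
  bcAdd_coeffMap f _ (latCont φ) v

theorem bcEquiv_mem (f : R →+* R') (φ : contAut r R) : bcEquiv f φ ∈ contAut r R' :=
  ⟨(continuous_iff_latCont (bcAdd f _ (latCont φ))).2 (latCont_bcAdd f _ (latCont φ)),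
    (continuous_iff_latCont (bcAdd f _ (latCont_symm φ))).2 (latCont_bcAdd f _ (latCont_symm φ))⟩

theorem ext_of_coeffMap (f : R →+* R') {A B : contAut r R'}
    (h : ∀ v, A.1 (coeffMap r f v) = B.1 (coeffMap r f v)) : A = B := by
  refine Subtype.ext (AlgEquiv.ext fun v => ?_)
  exact DFunLike.congr_fun (algHom_ext_of_coeffMap f (latCont A) (latCont B) h) v

/-- Base change along `f : R → R'` as a homomorphism of groups. -/
def baseChange (r : ℕ) (f : R →+* R') : contAut r R →* contAut r R' where
  toFun φ := ⟨bcEquiv f φ, bcEquiv_mem f φ⟩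
  map_one' := ext_of_coeffMap f fun v => by
    simp [bcEquiv_coeffMap]
  map_mul' φ ψ := ext_of_coeffMap f fun v => by
    simp [bcEquiv_coeffMap]

theorem baseChange_coeffMap (f : R →+* R') (φ : contAut r R) (v : V r R) :
    (baseChange r f φ).1 (coeffMap r f v) = coeffMap r f (φ.1 v) :=
  bcEquiv_coeffMap f φ v

theorem coeffMap_id (v : V r R) : coeffMap r (RingHom.id R) v = v := rfl

theorem coeffMap_comp {R'' : Type u} [CommRing R''] (g : R' →+* R'') (f : R →+* R') (v : V r R) :
    coeffMap r (g.comp f) v = coeffMap r g (coeffMap r f v) := rfl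

end BaseChange

section Functors

/-- The functor `R ↦ Aut_R (R((z_1)) × ⋯ × R((z_r)))` of continuous automorphisms. -/
def autRing (r : ℕ) : CommRingCat.{u} ⥤ GrpCat.{u} where
  obj R := GrpCat.of (contAut r R)
  map f := GrpCat.ofHom (baseChange r f.hom)
  map_id R := by
    ext φ : 2
    refine ext_of_coeffMap (RingHom.id R) fun v => ?_
    exact baseChange_coeffMap (RingHom.id R) φ v
  map_comp f g := by
    ext φ : 2
    refine ext_of_coeffMap (g.hom.comp f.hom) fun v => ?_
    refine (baseChange_coeffMap (g.hom.comp f.hom) φ v).trans ?_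
    rw [coeffMap_comp, coeffMap_comp]
    refine Eq.trans ?_ (baseChange_coeffMap g.hom (baseChange r f.hom φ) (coeffMap r f.hom v)).symm
    rw [baseChange_coeffMap]

variable (k : Type u) [Field k]

/-- The category of `k`-schemes. -/
abbrev Sch : Type (u + 1) := Over (Spec (CommRingCat.of k))

/-- The functor which sends a `k`-scheme `S` to the ring `H⁰(S, O_S)`. -/
def globalSections : (Sch k)ᵒᵖ ⥤ CommRingCat.{u} :=
  (Over.forget (Spec (CommRingCat.of k))).op ⋙ Scheme.Γ

/-- The functor of automorphisms of `V = k((z_1)) × ⋯ × k((z_r))`: it sends a `k`-scheme `S` to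
the group of continuous automorphisms of the `H⁰(S, O_S)`-algebra `V r H⁰(S, O_S)`. -/
def autV (r : ℕ) : (Sch k)ᵒᵖ ⥤ GrpCat.{u} :=
  globalSections k ⋙ autRing r

/-- The functor `G` of automorphisms of `k((z))`, which is the case of one factor. -/
abbrev virG : (Sch k)ᵒᵖ ⥤ GrpCat.{u} := autV k 1

/-- The product of `r` copies of a functor in groups. -/
def powFunctor {C : Type*} [Category C] (F : C ⥤ GrpCat.{u}) (r : ℕ) : C ⥤ GrpCat.{u} where
  obj X := GrpCat.of (Fin r → F.obj X)
  map f := GrpCat.ofHom ((F.map f).hom.compLeft (Fin r))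
  map_id X := by
    ext g : 2
    funext i
    simp [MonoidHom.compLeft]
  map_comp f f' := by
    ext g : 2
    funext i
    simp [MonoidHom.compLeft]

/-- The automorphism of `R((z_1)) × ⋯ × R((z_r))` which acts on the factor `i` by `g i`. -/
def diagEquiv {r : ℕ} {R : Type u} [CommRing R] (g : Fin r → (V 1 R ≃ₐ[R] V 1 R)) :
    V r R ≃ₐ[R] V r R where
  toFun v i := g i (fun _ => v i) 0
  invFun v i := (g i).symm (fun _ => v i) 0
  left_inv v := by
    funext i
    have h : (fun _ => g i (fun _ => v i) 0 : V 1 R) = g i (fun _ => v i) := by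
      funext j
      rw [Subsingleton.elim j 0]
    simp only [h, AlgEquiv.symm_apply_apply]
  right_inv v := by
    funext i
    have h : (fun _ => (g i).symm (fun _ => v i) 0 : V 1 R) = (g i).symm (fun _ => v i) := by
      funext j
      rw [Subsingleton.elim j 0]
    simp only [h, AlgEquiv.apply_symm_apply]
  map_mul' v w := by
    funext i
    exact congrFun (map_mul (g i) (fun _ => v i) (fun _ => w i)) 0
  map_add' v w := by
    funext i
    exact congrFun (map_add (g i) (fun _ => v i) (fun _ => w i)) 0
  commutes' c := by
    funext i
    exact congrFun ((g i).commutes c) 0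

theorem latCont_diagEquiv {r : ℕ} {R : Type u} [CommRing R] (g : Fin r → (V 1 R ≃ₐ[R] V 1 R))
    (hg : ∀ i, LatCont (((g i : V 1 R ≃ₐ[R] V 1 R) : V 1 R →ₐ[R] V 1 R) : V 1 R →+ V 1 R)) :
    LatCont ((diagEquiv g : V r R →ₐ[R] V r R) : V r R →+ V r R) := by
  intro n
  choose m hm using fun i => hg i n
  obtain ⟨M, hM⟩ := Finset.exists_le (Finset.univ.image m)
  refine ⟨M, fun v hv i l hl => ?_⟩
  exact hm i (fun _ => v i) (fun _ l' hl' => hv i l' (lt_of_lt_of_le hl'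
    (hM _ (Finset.mem_image_of_mem m (Finset.mem_univ i))))) 0 l hl

/-- The inclusion of the group of `r`-tuples of continuous automorphisms of `R((z))` into the group
of continuous automorphisms of `R((z_1)) × ⋯ × R((z_r))`. -/
def diagHom (r : ℕ) (R : Type u) [CommRing R] : (Fin r → contAut 1 R) →* contAut r R where
  toFun g := ⟨diagEquiv fun i => (g i).1,
    (continuous_iff_latCont ((diagEquiv fun i => (g i).1 : V r R →ₐ[R] V r R) : V r R →+ V r R)).2
      (latCont_diagEquiv _ fun i => latCont (g i)),
    (continuous_iff_latCont
      ((diagEquiv fun i => (g i).1.symm : V r R →ₐ[R] V r R) : V r R →+ V r R)).2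
      (latCont_diagEquiv _ fun i => latCont_symm (g i))⟩
  map_one' := rfl
  map_mul' g h := by
    refine Subtype.ext (AlgEquiv.ext fun v => ?_)
    funext i
    change (g i).1 ((h i).1 (fun _ => v i)) 0 = (g i).1 (fun _ => (h i).1 (fun _ => v i) 0) 0
    have e : (fun _ => (h i).1 (fun _ => v i) 0 : V 1 R) = (h i).1 (fun _ => v i) := by
      funext j
      rw [Subsingleton.elim j 0]
    rw [e]

theorem diagHom_apply {r : ℕ} {R : Type u} [CommRing R] (g : Fin r → contAut 1 R) (v : V r R)
    (i : Fin r) : (diagHom r R g).1 v i = (g i).1 (fun _ => v i) 0 := rfl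

theorem diagHom_baseChange {r : ℕ} {R R' : Type u} [CommRing R] [CommRing R'] (f : R →+* R')
    (g : Fin r → contAut 1 R) :
    diagHom r R' (fun i => baseChange 1 f (g i)) = baseChange r f (diagHom r R g) := by
  refine ext_of_coeffMap f fun v => ?_
  rw [baseChange_coeffMap]
  funext i
  rw [diagHom_apply]
  exact congrFun (baseChange_coeffMap f (g i) fun _ => v i) 0

/-- The canonical inclusion of `G × ⋯ × G` (`r` factors) into the functor of automorphisms
of `V`. -/
def inclG (r : ℕ) : powFunctor (virG k) r ⟶ autV k r where
  app S := GrpCat.ofHom (diagHom r ((globalSections k).obj S))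
  naturality _ _ f := by
    ext g : 2
    exact diagHom_baseChange ((globalSections k).map f).hom g

/-- The functor of points of the constant group scheme over `k` with group the symmetric group
`S_r`, that is, of the spectrum of the product of `r!` copies of `k`: the points with values in `S`
are the locally constant functions on `S` with values in `S_r`. -/
def symmGroup (r : ℕ) : (Sch k)ᵒᵖ ⥤ GrpCat.{u} where
  obj S := GrpCat.of (LocallyConstant S.unop.left (Equiv.Perm (Fin r)))
  map f := GrpCat.ofHom (LocallyConstant.comapMonoidHom ⟨f.unop.left, f.unop.left.continuous⟩)
  map_id _ := rfl
  map_comp _ _ := rfl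

/-- The permutation `σ(s)` for a point `σ` of `symmGroup k r` with values in `S` and `s ∈ S`. -/
def permAt {k : Type u} [Field k] {r : ℕ} (S : Sch k) (σ : (symmGroup k r).obj (op S))
    (s : S.left) : Equiv.Perm (Fin r) :=
  (show LocallyConstant S.left (Equiv.Perm (Fin r)) from σ) s

/-- The ideal of `R((z_1)) × ⋯ × R((z_r))` generated by `(0, …, z_i, …, 0)`. -/
def factorIdeal (r : ℕ) (R : Type u) [CommRing R] (i : Fin r) : Ideal (V r R) :=
  Ideal.span {mono i 1 1}

/-- The value `φ(s)` at the point `s` of the scheme `S` of a point `φ` of the functor of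
automorphisms of `V` with values in `S`. -/
def evalAt {k : Type u} [Field k] {r : ℕ} (S : Sch k) (φ : (autV k r).obj (op S)) (s : S.left) :
    contAut r (S.left.residueField s) :=
  baseChange r (S.left.Γevaluation s).hom φ

end Functors

section Formal

/-- A functor on the category of schemes over `B` is (the functor of points of) a formal scheme
if it is the direct limit of a directed system of schemes over `B` whose transition maps are
closed immersions with nilpotent ideal. -/
def IsFormalScheme {B : Scheme.{u}} (F : (Over B)ᵒᵖ ⥤ Type u) : Prop :=
  ∃ (J : Type u) (_ : Preorder J) (_ : IsDirectedOrder J) (_ : Nonempty J) (X : J ⥤ Over B),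
    (∀ ⦃i j : J⦄ (a : i ⟶ j), IsClosedImmersion (X.map a).left ∧ IsNilpotent (X.map a).left.ker) ∧
    ∃ c : X ⋙ yoneda ⟶ (Functor.const J).obj F, Nonempty (IsColimit (Cocone.mk F c))

/-- A functor in groups on the category of schemes over `B` is representable by a formal group
scheme if the underlying functor in sets is the functor of points of a formal scheme (which then
carries a unique compatible group structure). -/
def IsFormalGroupScheme {B : Scheme.{u}} (F : (Over B)ᵒᵖ ⥤ GrpCat.{u}) : Prop :=
  IsFormalScheme (F ⋙ forget GrpCat.{u})

end Formal

end

end Virasoro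

/-!
Write `z_i` for the variable of the factor `i` and `e_i` for the unit of that factor. The ring
`R` of global sections of a `k`-scheme contains the rational numbers. A continuous automorphism `φ`
of `V r R` is described by coordinates in `R`.

*Permutation of the factors.* The elements `φ (e_i)` are idempotents of `R((z))^r`. The derivation
`z d/dz` kills idempotents, so these have constant components, which form a matrix over `R` whose
rows and whose columns are complete systems of orthogonal idempotents (`isPermMat_permCoord`).
Conversely such a matrix defines an automorphism (`IsPermMat.aut`), and `φ` is the product of this
automorphism and one which fixes all `e_i`, which acts factor by factor
(`exists_eq_aut_mul_diagHom`). Over `R = H⁰(X, O_X)` an idempotent is determined by its values at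
the points of `X`, and every open and closed subset of `X` is the locus where some idempotent takes
the value `1`. Hence the matrices are the same as locally constant functions from `X` to the
symmetric group. This yields the morphism to the constant group, its kernel `range_diagHom`, and
the splitting `permAutHom`.

*The case of one factor.* An automorphism `φ` of `R((z))` is determined by the series `φ(z)`. The
series which occur are those of `IsCoord`: the coefficient of `z` is invertible, and those at
non-positive exponents are nilpotent. For necessity (`isCoord_contAut`) one passes to the quotients
by prime ideals: over a domain, continuity forces `φ(z)` to be a power series without constant term,
and if the coefficient of `z` vanished as well, then the image of `φ` could not contain `z`. For
sufficiency, the powers of such a series `a` tend to zero, so that `a` can be substituted for `z`.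
Modulo the ideal generated by the coefficients at non-positive exponents, the matrix of the
substitution is triangular with invertible diagonal. As this ideal is finitely generated by
nilpotents, it is nilpotent, and successive approximation proves surjectivity
(`IsCoord.surjective_subst`). A preimage of `z` is again a coordinate, and substituting it is the
inverse (`IsCoord.exists_inverse`).

*Representability.* By the two preceding parts, `φ` is the same as a permutation matrix of
idempotents together with `r` series which satisfy `IsCoord` (`contAut_ext_coord`,
`exists_contAut_of_coord`). When the order of the poles and the order of nilpotency of the
coefficients at non-positive exponents are bounded by `n`, these data are the points of an affine
scheme, the spectrum of `CoordRing k r n`. On the scheme with bound `n'`, the only coefficients at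
non-positive exponents which do not vanish are finitely many nilpotent ones, and modulo the ideal
which they generate all bounds hold; so the transition maps have nilpotent kernels
(`isNilpotent_ker_transition`). Every automorphism over a ring `R` has finitely many coefficients at
non-positive exponents, and therefore satisfies one of the bounds. Thus already the set of
automorphisms over each scheme `S` is the union of the sets of points of the approximating schemes
over `S`, without sheafification (`isColimit_approxCocone`).
-/

namespace Virasoro

noncomputable section

/-! ### Laurent series and the filtration by lattices -/

section Lattice

variable {r : ℕ} {R : Type u} [CommRing R]

theorem mul_mem_lattice {n m : ℤ} {v w : V r R} (hv : v ∈ lattice r R n)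
    (hw : w ∈ lattice r R m) : v * w ∈ lattice r R (n + m) := by
  intro i l hl
  rw [Pi.mul_apply, HahnSeries.coeff_mul]
  refine Finset.sum_eq_zero fun p hp => ?_
  have hp2 := (Finset.mem_antidiagonal.1 hp).2.2
  by_cases h : p.1 < n
  · rw [hv i _ h, zero_mul]
  · rw [hw i p.2 (by omega), mul_zero]

theorem coeff_mul_of_mem_lattice {n m : ℤ} {v w : V r R} (hv : v ∈ lattice r R n)
    (hw : w ∈ lattice r R m) (i : Fin r) :
    ((v * w) i).coeff (n + m) = (v i).coeff n * (w i).coeff m := by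
  rw [Pi.mul_apply, HahnSeries.coeff_mul, Finset.sum_eq_single (n, m)]
  · rintro ⟨p, q⟩ hp hne
    have hp2 := (Finset.mem_antidiagonal.1 hp).2.2
    simp only at hp2
    rcases lt_trichotomy p n with h | h | h
    · rw [hv i _ h, zero_mul]
    · exact absurd (Prod.ext h (by simp only; omega)) hne
    · rw [hw i q (by omega), mul_zero]
  · intro h
    by_contra hne
    exact h (Finset.mem_antidiagonal.2 ⟨left_ne_zero_of_mul hne, right_ne_zero_of_mul hne, rfl⟩)

theorem one_eq_sum_mono : (1 : V r R) = ∑ i, mono i 0 1 := by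
  funext j
  ext m
  rw [Finset.sum_apply, HahnSeries.coeff_sum, Finset.sum_eq_single j]
  · simp [mono_apply_coeff, HahnSeries.coeff_one]
  · intro i _ hi
    simp [mono_apply_coeff, hi.symm]
  · simp

theorem one_mem_lattice : (1 : V r R) ∈ lattice r R 0 := by
  rw [one_eq_sum_mono]
  exact Submodule.sum_mem _ fun i _ => mono_mem_lattice i le_rfl 1

theorem pow_mem_lattice {n : ℤ} {v : V r R} (hv : v ∈ lattice r R n) (k : ℕ) :
    v ^ k ∈ lattice r R (k * n) ∧ ∀ i, ((v ^ k) i).coeff (k * n) = (v i).coeff n ^ k := by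
  induction k with
  | zero => exact ⟨by simpa using one_mem_lattice, fun i => by simp⟩
  | succ k ih =>
    have e : ((k + 1 : ℕ) : ℤ) * n = k * n + n := by push_cast; ring
    rw [e, pow_succ]
    refine ⟨mul_mem_lattice ih.1 hv, fun i => ?_⟩
    rw [coeff_mul_of_mem_lattice ih.1 hv, ih.2, pow_succ]

theorem ofPowerSeries_mem_lattice (q : Fin r → PowerSeries R) :
    (fun i => HahnSeries.ofPowerSeries ℤ R (q i)) ∈ lattice r R 0 := fun i m hm => by
  change (HahnSeries.ofPowerSeries ℤ R (q i)).coeff m = 0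
  rw [PowerSeries.coeff_coe, if_pos hm]

theorem exists_inv_of_mem_lattice_zero {v : V r R} (hv : v ∈ lattice r R 0)
    (h0 : ∀ i, IsUnit ((v i).coeff 0)) : ∃ w ∈ lattice r R 0, v * w = 1 := by
  have key : ∀ i, ∃ q : PowerSeries R, v i * HahnSeries.ofPowerSeries ℤ R q = 1 := by
    intro i
    set p : PowerSeries R := PowerSeries.mk fun n => (v i).coeff n with hp
    have e : v i = HahnSeries.ofPowerSeries ℤ R p := by
      ext m
      rw [PowerSeries.coeff_coe]
      split_ifs with h
      · exact hv i m h
      · rw [hp, PowerSeries.coeff_mk, Int.natAbs_of_nonneg (not_lt.1 h)]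
    have hu : IsUnit p := by
      rw [PowerSeries.isUnit_iff_constantCoeff, ← PowerSeries.coeff_zero_eq_constantCoeff_apply, hp,
        PowerSeries.coeff_mk]
      exact h0 i
    obtain ⟨q, hq⟩ := hu.exists_right_inv
    exact ⟨q, by rw [e, ← map_mul, hq, map_one]⟩
  choose q hq using key
  exact ⟨_, ofPowerSeries_mem_lattice q, funext hq⟩

/-- A series whose coefficients vanish below a given exponent and whose coefficient at that exponent
is invertible is itself invertible. -/
theorem exists_inv_of_mem_lattice {n : ℤ} {v : V r R} (hv : v ∈ lattice r R n)
    (h0 : ∀ i, IsUnit ((v i).coeff n)) : ∃ w ∈ lattice r R (-n), v * w = 1 := by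
  set z : V r R := fun _ => HahnSeries.single (-n) 1 with hz
  have hzl : z ∈ lattice r R (-n) := fun i m hm => by simp [hz, hm.ne]
  have h1 : v * z ∈ lattice r R 0 := by simpa using mul_mem_lattice hv hzl
  obtain ⟨w, hw, hvw⟩ := exists_inv_of_mem_lattice_zero h1 fun i => by
    have := coeff_mul_of_mem_lattice hv hzl i
    rw [add_neg_cancel] at this
    rw [this]
    simpa [hz] using h0 i
  exact ⟨z * w, by simpa using mul_mem_lattice hzl hw, by rw [← mul_assoc, hvw]⟩

/-- The coefficients of the image of a series under a continuous endomorphism. -/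
theorem LatCont.coeff_apply {φ : V 1 R →ₐ[R] V 1 R} (hφ : LatCont (φ : V 1 R →+ V 1 R))
    (v : V 1 R) (m : ℤ) :
    ((φ v) 0).coeff m = ∑ᶠ n, (v 0).coeff n * ((φ (mono 0 n 1)) 0).coeff m := by
  have h := bcAdd_coeffMap (RingHom.id R) φ hφ v
  rw [coeffMap_id, coeffMap_id] at h
  rw [← h, bcAdd_coeff, Fin.sum_univ_one]
  rfl

end Lattice

/-! ### Substitution of a series for the variable -/

section Subst

variable {R : Type u} [CommRing R]

theorem mono_one_zero_one : (mono 0 0 1 : V 1 R) = 1 := by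
  rw [one_eq_sum_mono, Fin.sum_univ_one]

theorem subst_finite {w : ℤ → V 1 R} (hw : ∀ N, ∃ M, ∀ n, M ≤ n → w n ∈ lattice 1 R N)
    (v : V 1 R) (j : Fin 1) (m : ℤ) :
    (Function.support fun n => (v 0).coeff n * ((w n) j).coeff m).Finite := by
  obtain ⟨M, hM⟩ := hw (m + 1)
  obtain ⟨L, hL⟩ := exists_mem_lattice v
  refine (Set.finite_Ico L M).subset fun n hn => ⟨?_, ?_⟩
  · by_contra h
    exact hn (by simp only [hL 0 n (not_le.1 h), zero_mul])
  · by_contra h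
    exact hn (by simp only [hM n (not_lt.1 h) j m (by omega), mul_zero])

theorem subst_bddBelow {w : ℤ → V 1 R} (hw : ∀ N, ∃ M, ∀ n, M ≤ n → w n ∈ lattice 1 R N)
    (v : V 1 R) (j : Fin 1) :
    BddBelow (Function.support fun m => ∑ᶠ n, (v 0).coeff n * ((w n) j).coeff m) := by
  classical
  obtain ⟨M, hM⟩ := hw 0
  obtain ⟨L, hL⟩ := exists_mem_lattice v
  choose g hg using fun n => exists_mem_lattice (w n)
  obtain ⟨N, hN⟩ := Finset.exists_le (insert 0 ((Finset.Ico L M).image fun n => -g n))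
  refine ⟨-N, fun m hmem => not_lt.1 fun hm => hmem ?_⟩
  refine finsum_eq_zero_of_forall_eq_zero fun n => ?_
  rcases lt_or_ge n L with h | h
  · rw [hL 0 n h, zero_mul]
  · rcases lt_or_ge n M with h' | h'
    · have : -g n ≤ N := hN _ (Finset.mem_insert_of_mem (Finset.mem_image_of_mem (fun n => -g n)
        (Finset.mem_Ico.2 ⟨h, h'⟩)))
      rw [hg n j m (by omega), mul_zero]
    · have : (0 : ℤ) ≤ N := hN _ (Finset.mem_insert_self _ _)
      rw [hM n h' j m (by omega), mul_zero]

/-- The continuous `R`-linear map which sends `∑ c_n z^n` to `∑ c_n w_n`, for a family `w` which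
tends to zero as `n` tends to infinity. -/
def substLin (w : ℤ → V 1 R) (hw : ∀ N, ∃ M, ∀ n, M ≤ n → w n ∈ lattice 1 R N) :
    V 1 R →ₗ[R] V 1 R where
  toFun v j := HahnSeries.ofSuppBddBelow (fun m => ∑ᶠ n, (v 0).coeff n * ((w n) j).coeff m)
    (subst_bddBelow hw v j)
  map_add' v v' := by
    funext j
    ext m
    simp only [HahnSeries.coeff_ofSuppBddBelow, Pi.add_apply, HahnSeries.coeff_add]
    rw [← finsum_add_distrib (subst_finite hw v j m) (subst_finite hw v' j m)]
    exact finsum_congr fun n => by rw [add_mul]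
  map_smul' c v := by
    funext j
    ext m
    simp only [HahnSeries.coeff_ofSuppBddBelow, Pi.smul_apply, HahnSeries.coeff_smul,
      RingHom.id_apply]
    rw [smul_finsum' _ (subst_finite hw v j m)]
    exact finsum_congr fun n => by rw [smul_mul_assoc]

variable {w : ℤ → V 1 R} (hw : ∀ N, ∃ M, ∀ n, M ≤ n → w n ∈ lattice 1 R N)

theorem substLin_coeff (v : V 1 R) (j : Fin 1) (m : ℤ) :
    ((substLin w hw v) j).coeff m = ∑ᶠ n, (v 0).coeff n * ((w n) j).coeff m := rfl

theorem latCont_substLin : LatCont (substLin w hw).toAddMonoidHom := by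
  intro N
  obtain ⟨M, hM⟩ := hw N
  refine ⟨M, fun v hv j m hm => ?_⟩
  change ((substLin w hw v) j).coeff m = 0
  rw [substLin_coeff]
  refine finsum_eq_zero_of_forall_eq_zero fun n => ?_
  rcases lt_or_ge n M with h | h
  · rw [hv 0 n h, zero_mul]
  · rw [hM n h j m hm, mul_zero]

theorem substLin_mono (n : ℤ) (c : R) : substLin w hw (mono 0 n c) = c • w n := by
  funext j
  ext m
  rw [substLin_coeff, finsum_eq_single _ n]
  · simp [mono_apply_coeff]
  · intro l hl
    simp [mono_apply_coeff, hl]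

/-- Multiplicativity of `substLin` for a multiplicative family, by density of the monomials. -/
theorem substLin_mul (hmul : ∀ n m, w (n + m) = w n * w m) (v v' : V 1 R) :
    substLin w hw (v * v') = substLin w hw v * substLin w hw v' := by
  set A := (substLin w hw).toAddMonoidHom with hA
  have hB : LatCont A := latCont_substLin hw
  have hm : ∀ i n c, A (mono i n c) = c • w n := by
    intro i n c
    rw [Subsingleton.elim i 0]
    exact substLin_mono hw n c
  have h0 : ∀ i j n m c d, A (mono i n c * mono j m d) = A (mono i n c) * A (mono j m d) := by
    intro i j n m c d
    rw [Subsingleton.elim j i, mono_mul_mono, hm, hm, hm, hmul, smul_mul_smul_comm]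
  have h1 : ∀ i n c, A (mono i n c * v') = A (mono i n c) * A v' := fun i n c =>
    DFunLike.congr_fun (LatCont.ext (A := A.comp (AddMonoidHom.mulLeft (mono i n c)))
      (B := (AddMonoidHom.mulLeft (A (mono i n c))).comp A) (hB.comp (latCont_mulLeft _))
      ((latCont_mulLeft _).comp hB) fun j m d => h0 i j n m c d) v'
  exact DFunLike.congr_fun (LatCont.ext (A := A.comp (AddMonoidHom.mulRight v'))
    (B := (AddMonoidHom.mulRight (A v')).comp A) (hB.comp (latCont_mulRight _))
    ((latCont_mulRight _).comp hB) fun i n c => h1 i n c) v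

/-- The continuous `R`-algebra endomorphism which sends `∑ c_n z^n` to `∑ c_n w_n`, for a
multiplicative family `w` which tends to zero as `n` tends to infinity. -/
def substAlgHom (hmul : ∀ n m, w (n + m) = w n * w m) (h1 : w 0 = 1) : V 1 R →ₐ[R] V 1 R :=
  AlgHom.ofLinearMap (substLin w hw)
    (by rw [← mono_one_zero_one, substLin_mono, h1, one_smul, mono_one_zero_one])
    (substLin_mul hw hmul)

theorem latCont_substAlgHom (hmul : ∀ n m, w (n + m) = w n * w m) (h1 : w 0 = 1) :
    LatCont (substAlgHom hw hmul h1 : V 1 R →+ V 1 R) := latCont_substLin hw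

theorem substAlgHom_mono (hmul : ∀ n m, w (n + m) = w n * w m) (h1 : w 0 = 1) (n : ℤ) :
    substAlgHom hw hmul h1 (mono 0 n 1) = w n :=
  (substLin_mono hw n 1).trans (one_smul _ _)

/-- The variable `z`, as a unit of `R((z))`. -/
def zUnit (R : Type u) [CommRing R] : (V 1 R)ˣ where
  val := mono 0 1 1
  inv := mono 0 (-1) 1
  val_inv := by rw [mono_mul_mono, mul_one, add_neg_cancel, mono_one_zero_one]
  inv_val := by rw [mono_mul_mono, mul_one, neg_add_cancel, mono_one_zero_one]

theorem zUnit_zpow (n : ℤ) : ((zUnit R ^ n : (V 1 R)ˣ) : V 1 R) = mono 0 n 1 := by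
  have hnat : ∀ (e : ℤ) (k : ℕ), (mono 0 e 1 : V 1 R) ^ k = mono 0 (k * e) 1 := by
    intro e k
    induction k with
    | zero => simp [mono_one_zero_one]
    | succ k ih =>
      rw [pow_succ, ih, mono_mul_mono, mul_one]
      congr 1
      push_cast
      ring
  obtain ⟨k, rfl | rfl⟩ := n.eq_nat_or_neg
  · rw [zpow_natCast, Units.val_pow_eq_pow_val]
    exact (hnat 1 k).trans (by rw [mul_one])
  · rw [zpow_neg, zpow_natCast, ← inv_pow, Units.val_pow_eq_pow_val]
    exact (hnat (-1) k).trans (by rw [mul_neg_one])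

/-- A continuous endomorphism of `R((z))` is determined by the image of `z`. -/
theorem algHom_ext_of_mono_one {A B : V 1 R →ₐ[R] V 1 R} (hA : LatCont (A : V 1 R →+ V 1 R))
    (hB : LatCont (B : V 1 R →+ V 1 R)) (h : A (mono 0 1 1) = B (mono 0 1 1)) : A = B := by
  have hu : Units.map (A : V 1 R →* V 1 R) (zUnit R) = Units.map (B : V 1 R →* V 1 R) (zUnit R) :=
    Units.ext h
  refine AlgHom.ext fun v => DFunLike.congr_fun (LatCont.ext hA hB fun i n c => ?_) v
  change A (mono i n c) = B (mono i n c)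
  have hn := congrArg (fun x : (V 1 R)ˣ => ((x ^ n : (V 1 R)ˣ) : V 1 R)) hu
  simp only [← map_zpow, Units.coe_map] at hn
  rw [zUnit_zpow] at hn
  rw [Subsingleton.elim i 0, ← mul_one c, ← smul_mono, map_smul, map_smul]
  exact congrArg (c • ·) hn

end Subst

section IsCoord

variable {R : Type u} [CommRing R]

/-- The series which are images of `z` under continuous automorphisms of `R((z))`: the coefficient
of `z` is invertible, the coefficients at non-positive exponents are nilpotent. -/
def IsCoord (a : V 1 R) : Prop :=
  (∀ m ≤ 0, IsNilpotent ((a 0).coeff m)) ∧ IsUnit ((a 0).coeff 1)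

/-- The splitting of a coordinate into a nilpotent part and a power series without constant
term. -/
theorem IsCoord.exists_nilpotent_add {a : V 1 R} (ha : IsCoord a) :
    ∃ ν b : V 1 R, IsNilpotent ν ∧ b ∈ lattice 1 R 1 ∧ IsUnit ((b 0).coeff 1) ∧ a = ν + b := by
  obtain ⟨L, hL⟩ := exists_sum_mono a 1
  rw [Fin.sum_univ_one] at hL
  refine ⟨_, _, ?_, hL, ?_, (add_sub_cancel _ _).symm⟩
  · refine isNilpotent_sum fun n hn => ?_
    obtain ⟨k, hk⟩ := ha.1 n (by have := (Finset.mem_Ico.1 hn).2; omega)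
    have hpow : ∀ l : ℕ, ∃ e, (mono 0 n ((a 0).coeff n) : V 1 R) ^ l
        = mono 0 e ((a 0).coeff n ^ l) := by
      intro l
      induction l with
      | zero => exact ⟨0, by simp [mono_one_zero_one]⟩
      | succ l ih =>
        obtain ⟨e, he⟩ := ih
        exact ⟨e + n, by rw [pow_succ, he, mono_mul_mono, pow_succ]⟩
    obtain ⟨e, he⟩ := hpow k
    refine ⟨k, ?_⟩
    rw [he, hk]
    simp [mono]
  · have h0 : ((∑ n ∈ Finset.Ico L 1, mono 0 n ((a 0).coeff n) : V 1 R) 0).coeff 1 = 0 := by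
      rw [Finset.sum_apply, HahnSeries.coeff_sum]
      refine Finset.sum_eq_zero fun n hn => ?_
      have := (Finset.mem_Ico.1 hn).2
      rw [mono_apply_coeff, if_neg (by omega)]
    rw [Pi.sub_apply, HahnSeries.coeff_sub, h0, sub_zero]
    exact ha.2

theorem IsCoord.isUnit {a : V 1 R} (ha : IsCoord a) : IsUnit a := by
  obtain ⟨ν, b, hν, hb, hb1, rfl⟩ := ha.exists_nilpotent_add
  obtain ⟨w, -, hw⟩ := exists_inv_of_mem_lattice hb fun i => by rwa [Subsingleton.elim i 0]
  exact hν.isUnit_add_right_of_commute (IsUnit.of_mul_eq_one w hw) (Commute.all _ _)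

/-- The powers of a coordinate tend to zero. -/
theorem IsCoord.exists_pow_mem {a : V 1 R} (ha : IsCoord a) (N : ℤ) :
    ∃ M : ℕ, ∀ n, M ≤ n → a ^ n ∈ lattice 1 R N := by
  obtain ⟨ν, b, ⟨k, hk⟩, hb, -, rfl⟩ := ha.exists_nilpotent_add
  obtain ⟨c, hc⟩ := exists_mem_lattice ν
  -- In the binomial expansion of `(ν + b) ^ n` only the terms with at most `k` factors `ν` remain.
  refine ⟨(k + k * |c| + |N|).toNat, fun n hn => ?_⟩
  have hkc : 0 ≤ (k : ℤ) * |c| := by positivity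
  have hn' : k + k * |c| + |N| ≤ n := by
    have := abs_nonneg N
    omega
  rw [add_pow]
  refine Submodule.sum_mem _ fun m hm => ?_
  rcases le_or_gt k m with h | h
  · rw [pow_eq_zero_of_le h hk, zero_mul, zero_mul]
    exact Submodule.zero_mem _
  · rw [← nsmul_eq_mul']
    refine Submodule.smul_of_tower_mem _ _ (lattice_antitone ?_ (mul_mem_lattice
      (pow_mem_lattice hc m).1 (pow_mem_lattice hb (n - m)).1))
    have h1 : -(k * |c|) ≤ m * c := by
      have h2 : (m : ℤ) * -|c| ≤ m * c := by gcongr; exact neg_abs_le c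
      have h3 : (m : ℤ) * |c| ≤ k * |c| := by gcongr
      linarith
    have h4 := le_abs_self N
    push_cast [Nat.cast_sub (show m ≤ n by have := Finset.mem_range.1 hm; omega)]
    have : (m : ℤ) < k := by exact_mod_cast h
    linarith

theorem IsCoord.tendsto {a : V 1 R} (ha : IsCoord a) (N : ℤ) :
    ∃ M : ℤ, ∀ n, M ≤ n → ((ha.isUnit.unit ^ n : (V 1 R)ˣ) : V 1 R) ∈ lattice 1 R N := by
  obtain ⟨M, hM⟩ := ha.exists_pow_mem N
  refine ⟨M, fun n hn => ?_⟩
  obtain ⟨k, rfl⟩ := Int.eq_ofNat_of_zero_le (le_trans (by positivity) hn)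
  have := hM k (by exact_mod_cast hn)
  simpa using this

/-- The substitution of a coordinate `a` for `z`. -/
def IsCoord.subst {a : V 1 R} (ha : IsCoord a) : V 1 R →ₐ[R] V 1 R :=
  substAlgHom ha.tendsto (fun n m => by rw [zpow_add, Units.val_mul]) (by simp)

theorem IsCoord.latCont_subst {a : V 1 R} (ha : IsCoord a) :
    LatCont (ha.subst : V 1 R →+ V 1 R) := latCont_substAlgHom _ _ _

theorem IsCoord.subst_mono {a : V 1 R} (ha : IsCoord a) (n : ℤ) :
    ha.subst (mono 0 n 1) = ((ha.isUnit.unit ^ n : (V 1 R)ˣ) : V 1 R) := substAlgHom_mono _ _ _ _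

theorem IsCoord.subst_mono_one {a : V 1 R} (ha : IsCoord a) : ha.subst (mono 0 1 1) = a := by
  rw [ha.subst_mono, zpow_one, IsUnit.unit_spec]

end IsCoord

/-! ### Continuous automorphisms of `R((z))` -/

section Triangular

variable {R : Type u} [CommRing R]

theorem zpow_mem_lattice {u : (V 1 R)ˣ} (hu : (u : V 1 R) ∈ lattice 1 R 1)
    (hu1 : IsUnit (((u : V 1 R) 0).coeff 1)) (n : ℤ) :
    ((u ^ n : (V 1 R)ˣ) : V 1 R) ∈ lattice 1 R n ∧
      IsUnit ((((u ^ n : (V 1 R)ˣ) : V 1 R) 0).coeff n) := by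
  have hnat : ∀ (u : (V 1 R)ˣ) (e : ℤ), (u : V 1 R) ∈ lattice 1 R e →
      IsUnit (((u : V 1 R) 0).coeff e) → ∀ k : ℕ,
      ((u ^ k : (V 1 R)ˣ) : V 1 R) ∈ lattice 1 R (k * e) ∧
      IsUnit ((((u ^ k : (V 1 R)ˣ) : V 1 R) 0).coeff (k * e)) := by
    intro u e hu hu1 k
    rw [Units.val_pow_eq_pow_val]
    obtain ⟨h1, h2⟩ := pow_mem_lattice hu k
    exact ⟨h1, by rw [h2]; exact hu1.pow k⟩
  obtain ⟨k, rfl | rfl⟩ := n.eq_nat_or_neg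
  · rw [zpow_natCast]
    simpa only [mul_one] using hnat u 1 hu hu1 k
  · obtain ⟨w, hw, huw⟩ := exists_inv_of_mem_lattice hu fun i => by rwa [Subsingleton.elim i 0]
    have e : w = ((u⁻¹ : (V 1 R)ˣ) : V 1 R) := (Units.inv_eq_of_mul_eq_one_right huw).symm
    have h1 : IsUnit ((w 0).coeff (-1)) := by
      have h := coeff_mul_of_mem_lattice hu hw 0
      rw [huw, add_neg_cancel] at h
      exact IsUnit.of_mul_eq_one_right _ (h.symm.trans (by simp))
    rw [zpow_neg, zpow_natCast, ← inv_pow]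
    simpa only [mul_neg_one] using hnat u⁻¹ (-1) (e ▸ hw) (e ▸ h1) k

/-- Modulo an ideal which contains the coefficients at non-positive exponents of a unit `u`, the
powers of `u` form a triangular matrix of coefficients. -/
theorem zpow_coeff_mem (I : Ideal R) {u : (V 1 R)ˣ} (hu : ∀ m ≤ 0, ((u : V 1 R) 0).coeff m ∈ I)
    (hu1 : IsUnit (Ideal.Quotient.mk I (((u : V 1 R) 0).coeff 1))) (n : ℤ) :
    (∀ m < n, (((u ^ n : (V 1 R)ˣ) : V 1 R) 0).coeff m ∈ I) ∧
      IsUnit (Ideal.Quotient.mk I ((((u ^ n : (V 1 R)ˣ) : V 1 R) 0).coeff n)) := by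
  obtain ⟨h1, h2⟩ := zpow_mem_lattice
    (u := Units.map (coeffMap 1 (Ideal.Quotient.mk I)).toMonoidHom u)
    (fun i m hm => by
      rw [Subsingleton.elim i 0]
      exact Ideal.Quotient.eq_zero_iff_mem.2 (hu m (by omega))) hu1 n
  rw [← map_zpow] at h1 h2
  exact ⟨fun m hm => Ideal.Quotient.eq_zero_iff_mem.1 (h1 0 m hm), h2⟩

variable {φ : V 1 R →ₐ[R] V 1 R}

/-- The coefficients of the image of a series, modulo an ideal for which the matrix of `φ` is
triangular. -/
theorem LatCont.coeff_sub_sum_mem (hφ : LatCont (φ : V 1 R →+ V 1 R)) {I J : Ideal R}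
    (hI : ∀ n, ∀ m < n, ((φ (mono 0 n 1)) 0).coeff m ∈ I) {L : ℤ} {v : V 1 R}
    (hv : v ∈ lattice 1 R L) (hJ : ∀ m, (v 0).coeff m ∈ J) (k : ℕ) :
    ((φ v) 0).coeff (L + k) - ∑ l ∈ Finset.range (k + 1),
      (v 0).coeff (L + l) * ((φ (mono 0 (L + l) 1)) 0).coeff (L + k) ∈ I * J := by
  obtain ⟨M, hM⟩ := hφ (L + k + 1)
  set f : ℤ → R := fun n => (v 0).coeff n * ((φ (mono 0 n 1)) 0).coeff (L + k) with hf
  set K := (M - L).toNat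
  set e : ℕ ↪ ℤ := Nat.castEmbedding.trans (addLeftEmbedding L)
  have he : ∀ l : ℕ, e l = L + l := fun _ => rfl
  have hsupp : Function.support f ⊆ ((Finset.range (k + 1 + K)).map e : Finset ℤ) := by
    intro n hn
    have h1 : L ≤ n := by
      by_contra h
      exact hn (by simp only [hf, hv 0 n (not_le.1 h), zero_mul])
    have h2 : n < M := by
      by_contra h
      have := hM _ (mono_mem_lattice 0 (not_lt.1 h) 1) 0 (L + k) (by omega)
      exact hn (by simp only [hf]; rw [show ((φ (mono 0 n 1)) 0).coeff (L + k) = 0 from this,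
        mul_zero])
    simp only [Finset.coe_map, Set.mem_image, Finset.mem_coe, Finset.mem_range]
    exact ⟨(n - L).toNat, by omega, by rw [he]; omega⟩
  rw [hφ.coeff_apply, finsum_eq_sum_of_support_subset f hsupp, Finset.sum_map,
    Finset.sum_range_add]
  simp only [he]
  rw [add_sub_cancel_left]
  refine Ideal.sum_mem _ fun l _ => ?_
  rw [hf, mul_comm I J]
  exact Ideal.mul_mem_mul (hJ _) (hI _ _ (by push_cast; omega))

/-- A triangular system of linear equations can be solved modulo the ideal `I` which measures the
failure of triangularity. -/
theorem LatCont.exists_sub_mem (hφ : LatCont (φ : V 1 R →+ V 1 R)) {I J : Ideal R}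
    (hI : ∀ n, ∀ m < n, ((φ (mono 0 n 1)) 0).coeff m ∈ I)
    (hu : ∀ n, IsUnit (Ideal.Quotient.mk I (((φ (mono 0 n 1)) 0).coeff n))) {y : V 1 R}
    (hy : ∀ m, (y 0).coeff m ∈ J) : ∃ x : V 1 R, ∀ m, ((y - φ x) 0).coeff m ∈ I * J := by
  obtain ⟨L, hL⟩ := exists_mem_lattice y
  have hc : ∀ n, ∃ c, 1 - ((φ (mono 0 n 1)) 0).coeff n * c ∈ I := by
    intro n
    obtain ⟨c, hc⟩ := (hu n).exists_right_inv
    obtain ⟨c, rfl⟩ := Ideal.Quotient.mk_surjective c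
    exact ⟨c, by rw [← Ideal.Quotient.eq_zero_iff_mem, map_sub, map_mul, hc, map_one, sub_self]⟩
  choose c hc using hc
  set W : ℕ → ℕ → R := fun l k => ((φ (mono 0 (L + l) 1)) 0).coeff (L + k) with hW
  -- The coefficient of the solution at `L + k` is found by recursion on `k`, dividing by the
  -- diagonal entry modulo `I`.
  set x : ℕ → R := WellFounded.fix Nat.lt_wfRel.wf fun k ih =>
    c (L + k) * ((y 0).coeff (L + k) - ∑ l : Fin k, ih l l.2 * W l k) with hx
  have hxk : ∀ k, x k = c (L + k) * ((y 0).coeff (L + k) - ∑ l ∈ Finset.range k, x l * W l k) := by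
    intro k
    rw [← Fin.sum_univ_eq_sum_range (fun l => x l * W l k) k, hx, WellFounded.fix_eq]
  have hxJ : ∀ k, x k ∈ J := by
    intro k
    induction k using Nat.strong_induction_on with
    | _ k ih =>
      rw [hxk]
      exact Ideal.mul_mem_left _ _ (Ideal.sub_mem _ (hy _) (Ideal.sum_mem _ fun l hl =>
        Ideal.mul_mem_right _ _ (ih l (Finset.mem_range.1 hl))))
  set v : V 1 R := fun _ => HahnSeries.ofSuppBddBelow
    (fun n => if n < L then 0 else x (n - L).toNat)
    ⟨L, fun n hn => not_lt.1 fun h => Function.mem_support.1 hn (if_pos h)⟩ with hv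
  have hvc : ∀ i m, (v i).coeff m = if m < L then 0 else x (m - L).toNat := fun _ _ => rfl
  have hvl : v ∈ lattice 1 R L := fun i m hm => (hvc i m).trans (if_pos hm)
  have hvk : ∀ l : ℕ, (v 0).coeff (L + l) = x l := by
    intro l
    rw [hvc 0, if_neg (by omega)]
    congr 1
    omega
  have hvJ : ∀ m, (v 0).coeff m ∈ J := by
    intro m
    rw [hvc 0]
    split_ifs
    exacts [J.zero_mem, hxJ _]
  refine ⟨v, fun m => ?_⟩
  rw [Pi.sub_apply, HahnSeries.coeff_sub]
  rcases lt_or_ge m L with h | h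
  · rw [hL 0 m h, zero_sub, neg_mem_iff, hφ.coeff_apply]
    refine finsum_induction (· ∈ I * J) (Ideal.zero_mem _) (fun _ _ => Ideal.add_mem _) fun n => ?_
    rcases lt_or_ge m n with h' | h'
    · rw [mul_comm I J]
      exact Ideal.mul_mem_mul (hvJ n) (hI n m h')
    · rw [hvl 0 n (by omega), zero_mul]
      exact Ideal.zero_mem _
  · obtain ⟨k, rfl⟩ : ∃ k : ℕ, m = L + k := ⟨(m - L).toNat, by omega⟩
    have h1 := hφ.coeff_sub_sum_mem hI hvl hvJ k
    rw [Finset.sum_range_succ] at h1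
    simp only [hvk] at h1
    have h2 : (1 - W k k * c (L + k)) * ((y 0).coeff (L + k) - ∑ l ∈ Finset.range k, x l * W l k)
        ∈ I * J := Ideal.mul_mem_mul (hc _) (Ideal.sub_mem _ (hy _) (Ideal.sum_mem _ fun l _ =>
          Ideal.mul_mem_right _ _ (hxJ l)))
    have h3 := Ideal.sub_mem _ h2 h1
    convert h3 using 1
    have h4 := hxk k
    simp only [hW] at h4 ⊢
    linear_combination (-((φ (mono 0 (L + k) 1)) 0).coeff (L + k)) * h4

/-- Each step of the successive approximation improves the error by one power of `I`. -/
theorem LatCont.surjective_of_isNilpotent (hφ : LatCont (φ : V 1 R →+ V 1 R)) {I : Ideal R}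
    (hnil : IsNilpotent I) (hI : ∀ n, ∀ m < n, ((φ (mono 0 n 1)) 0).coeff m ∈ I)
    (hu : ∀ n, IsUnit (Ideal.Quotient.mk I (((φ (mono 0 n 1)) 0).coeff n))) :
    Function.Surjective φ := by
  obtain ⟨K, hK⟩ := hnil
  have key : ∀ d j, j + d = K → ∀ y : V 1 R, (∀ m, (y 0).coeff m ∈ I ^ j) → ∃ x, φ x = y := by
    intro d
    induction d with
    | zero =>
      intro j hj y hy
      refine ⟨0, ?_⟩
      rw [map_zero]
      funext i
      ext m
      have := hy m
      rw [show j = K by omega, hK] at this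
      rw [Subsingleton.elim i 0, (Ideal.mem_bot.1 this : (y 0).coeff m = 0)]
      rfl
    | succ d ih =>
      intro j hj y hy
      obtain ⟨x, hx⟩ := hφ.exists_sub_mem hI hu hy
      obtain ⟨x', hx'⟩ := ih (j + 1) (by omega) (y - φ x) fun m => by
        rw [pow_succ']
        exact hx m
      exact ⟨x + x', by rw [map_add, hx', add_sub_cancel]⟩
  intro y
  exact key K 0 (by omega) y fun m => by simp

end Triangular

section Coordinates

variable {R : Type u} [CommRing R]

theorem IsCoord.exists_nilpotent_ideal {a : V 1 R} (ha : IsCoord a) :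
    ∃ I : Ideal R, IsNilpotent I ∧ ∀ m ≤ 0, (a 0).coeff m ∈ I := by
  classical
  obtain ⟨L, hL⟩ := exists_mem_lattice a
  refine ⟨Ideal.span ((Finset.Ico L 1).image fun m => (a 0).coeff m : Finset R), ?_, fun m hm => ?_⟩
  · rw [Ideal.FG.isNilpotent_iff_le_nilradical ⟨_, rfl⟩, Ideal.span_le]
    intro c hc
    obtain ⟨m, hm, rfl⟩ := Finset.mem_image.1 (Finset.mem_coe.1 hc)
    exact ha.1 m (by have := (Finset.mem_Ico.1 hm).2; omega)
  · rcases lt_or_ge m L with h | h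
    · rw [hL 0 m h]
      exact Ideal.zero_mem _
    · exact Ideal.subset_span (Finset.mem_coe.2 (Finset.mem_image_of_mem (fun m => (a 0).coeff m)
        (Finset.mem_Ico.2 ⟨h, by omega⟩)))

theorem IsCoord.subst_triangular {a : V 1 R} (ha : IsCoord a) {I : Ideal R}
    (hI : ∀ m ≤ 0, (a 0).coeff m ∈ I) (n : ℤ) :
    (∀ m < n, ((ha.subst (mono 0 n 1)) 0).coeff m ∈ I) ∧
      IsUnit (Ideal.Quotient.mk I (((ha.subst (mono 0 n 1)) 0).coeff n)) := by
  rw [ha.subst_mono]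
  exact zpow_coeff_mem I hI (ha.2.map _) n

theorem IsCoord.surjective_subst {a : V 1 R} (ha : IsCoord a) : Function.Surjective ha.subst := by
  obtain ⟨I, hI, hI'⟩ := ha.exists_nilpotent_ideal
  exact ha.latCont_subst.surjective_of_isNilpotent hI (fun n => (ha.subst_triangular hI' n).1)
    fun n => (ha.subst_triangular hI' n).2

/-- The conditions on a coordinate can be checked modulo all prime ideals. -/
theorem isCoord_iff_forall_prime {a : V 1 R} : IsCoord a ↔ ∀ P : Ideal R, P.IsPrime →
    (∀ m ≤ 0, (a 0).coeff m ∈ P) ∧ (a 0).coeff 1 ∉ P := by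
  constructor
  · intro ha P hP
    refine ⟨fun m hm => ?_, fun h => hP.ne_top (Ideal.eq_top_of_isUnit_mem _ h ha.2)⟩
    obtain ⟨k, hk⟩ := ha.1 m hm
    exact hP.mem_of_pow_mem k (by rw [hk]; exact P.zero_mem)
  · intro h
    refine ⟨fun m hm => ?_, ?_⟩
    · rw [nilpotent_iff_mem_prime]
      exact fun P hP => (h P hP).1 m hm
    · by_contra hu
      obtain ⟨P, hP, hm⟩ := exists_max_ideal_of_mem_nonunits hu
      exact (h P hP.isPrime).2 hm

/-- A series which becomes `z` after the substitution of a coordinate is a coordinate. -/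
theorem IsCoord.of_subst_eq {a b : V 1 R} (ha : IsCoord a) (hb : ha.subst b = mono 0 1 1) :
    IsCoord b := by
  rw [isCoord_iff_forall_prime]
  intro P hP
  have hI := fun n => (ha.subst_triangular (isCoord_iff_forall_prime.1 ha P hP).1 n)
  obtain ⟨L', hL'⟩ := exists_mem_lattice b
  obtain ⟨L, hL, hL1⟩ : ∃ L : ℤ, b ∈ lattice 1 R L ∧ L ≤ 0 :=
    ⟨min L' 0, lattice_antitone (min_le_left _ _) hL', min_le_right _ _⟩
  have hsum := fun k => ha.latCont_subst.coeff_sub_sum_mem (J := ⊤) (fun n => (hI n).1) hL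
    (fun _ => Submodule.mem_top) k
  simp only [hb, Ideal.mul_top, Finset.sum_range_succ] at hsum
  have hW : ∀ n, ((ha.subst (mono 0 n 1)) 0).coeff n ∉ P := by
    intro n hn
    have := (hI n).2
    rw [Ideal.Quotient.eq_zero_iff_mem.2 hn, isUnit_zero_iff] at this
    exact hP.ne_top ((Ideal.eq_top_iff_one P).2 (Ideal.Quotient.eq_zero_iff_mem.1 (by
      rw [map_one, this])))
  -- Modulo `P` the first coefficient of `b` which does not vanish would make the image of
  -- `b`, which is `z`, nonzero at the same exponent, by triangularity.
  have hneg : ∀ k : ℕ, L + k ≤ 0 → (b 0).coeff (L + k) ∈ P := by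
    intro k
    induction k using Nat.strong_induction_on with
    | _ k ih =>
      intro hk
      have h1 := hsum k
      have h2 : ((mono 0 1 1 : V 1 R) 0).coeff (L + k) = 0 := by
        rw [mono_apply_coeff, if_neg (by omega)]
      rw [h2, zero_sub, neg_mem_iff] at h1
      refine (hP.mem_or_mem ((P.add_mem_iff_right ?_).1 h1)).resolve_right (hW _)
      exact Ideal.sum_mem _ fun l hl => Ideal.mul_mem_right _ _ (ih l (Finset.mem_range.1 hl)
        (by have := Finset.mem_range.1 hl; omega))
  constructor
  · intro m hm
    rcases lt_or_ge m L with h | h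
    · rw [hL 0 m h]
      exact P.zero_mem
    · obtain ⟨k, rfl⟩ : ∃ k : ℕ, m = L + k := ⟨(m - L).toNat, by omega⟩
      exact hneg k hm
  · intro h
    have h1 := hsum (1 - L).toNat
    have e : L + (1 - L).toNat = 1 := by omega
    rw [e, mono_apply_coeff, if_pos ⟨rfl, rfl⟩] at h1
    apply hP.ne_top
    rw [Ideal.eq_top_iff_one]
    refine (sub_add_cancel (1 : R) _) ▸ P.add_mem h1 ?_
    refine P.add_mem (Ideal.sum_mem _ fun l hl => Ideal.mul_mem_right _ _ (hneg l ?_))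
      (P.mul_mem_right _ h)
    have := Finset.mem_range.1 hl
    omega

theorem LatCont.algHom_comp {A B : V 1 R →ₐ[R] V 1 R} (hA : LatCont (A : V 1 R →+ V 1 R))
    (hB : LatCont (B : V 1 R →+ V 1 R)) :
    LatCont ((A.comp B : V 1 R →ₐ[R] V 1 R) : V 1 R →+ V 1 R) :=
  LatCont.comp (B := (A : V 1 R →+ V 1 R)) hA hB

theorem latCont_id : LatCont ((AlgHom.id R (V r R) : V r R →ₐ[R] V r R) : V r R →+ V r R) :=
  fun n => ⟨n, fun _ hv => hv⟩

/-- Coordinates form a group under substitution. -/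
theorem IsCoord.exists_inverse {a : V 1 R} (ha : IsCoord a) : ∃ (b : V 1 R) (hb : IsCoord b),
    ha.subst.comp hb.subst = AlgHom.id R _ ∧ hb.subst.comp ha.subst = AlgHom.id R _ := by
  have key : ∀ {a : V 1 R} (ha : IsCoord a), ∃ (b : V 1 R) (hb : IsCoord b),
      ha.subst.comp hb.subst = AlgHom.id R _ := by
    intro a ha
    obtain ⟨b, hb⟩ := ha.surjective_subst (mono 0 1 1)
    refine ⟨b, ha.of_subst_eq hb, algHom_ext_of_mono_one
      (ha.latCont_subst.algHom_comp (ha.of_subst_eq hb).latCont_subst) latCont_id ?_⟩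
    rw [AlgHom.comp_apply, IsCoord.subst_mono_one, hb, AlgHom.id_apply]
  obtain ⟨b, hb, hab⟩ := key ha
  obtain ⟨c, hc, hbc⟩ := key hb
  refine ⟨b, hb, hab, ?_⟩
  have : ha.subst = hc.subst := by
    rw [← AlgHom.comp_id ha.subst, ← hbc, ← AlgHom.comp_assoc, hab, AlgHom.id_comp]
  rw [this, hbc]

theorem IsCoord.exists_contAut {a : V 1 R} (ha : IsCoord a) :
    ∃ g : contAut 1 R, g.1 (mono 0 1 1) = a := by
  obtain ⟨b, hb, hab, hba⟩ := ha.exists_inverse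
  refine ⟨⟨AlgEquiv.ofAlgHom ha.subst hb.subst hab hba,
    (continuous_iff_latCont (ha.subst : V 1 R →+ V 1 R)).2 ha.latCont_subst,
    (continuous_iff_latCont (hb.subst : V 1 R →+ V 1 R)).2 hb.latCont_subst⟩, ?_⟩
  exact ha.subst_mono_one

theorem contAut_one_ext {g g' : contAut 1 R} (h : g.1 (mono 0 1 1) = g'.1 (mono 0 1 1)) :
    g = g' := by
  refine Subtype.ext (AlgEquiv.ext fun v => ?_)
  exact DFunLike.congr_fun (algHom_ext_of_mono_one (latCont g) (latCont g') h) v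

theorem mono_one_pow (k : ℕ) : (mono 0 1 1 : V 1 R) ^ k = mono 0 (k : ℤ) 1 := by
  have := zUnit_zpow (R := R) k
  rwa [zpow_natCast, Units.val_pow_eq_pow_val] at this

/-- Over a domain the order of a power of a series is a multiple of the order of the series, so a
series of order at most zero is not topologically nilpotent. -/
theorem coeff_mem_of_pow_mem_lattice {P : Ideal R} [P.IsPrime] {a : V 1 R} {n : ℕ}
    (h : a ^ n ∈ lattice 1 R 1) {m : ℤ} (hm : m ≤ 0) : (a 0).coeff m ∈ P := by
  set π := Ideal.Quotient.mk P
  rw [← Ideal.Quotient.eq_zero_iff_mem]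
  change ((coeffMap 1 π a) 0).coeff m = 0
  set x := (coeffMap 1 π a) 0 with hx
  by_cases hx0 : x = 0
  · rw [hx0, HahnSeries.coeff_zero]
  refine HahnSeries.coeff_eq_zero_of_lt_order (lt_of_le_of_lt hm ?_)
  have hpow : x ^ n = (coeffMap 1 π (a ^ n)) 0 := by
    rw [map_pow, Pi.pow_apply]
  have h1 : 0 < (x ^ n).order := by
    by_contra hle
    have hne := mt HahnSeries.coeff_order_eq_zero.1 (pow_ne_zero n hx0)
    rw [hpow, coeffMap_coeff, h 0 _ (by rw [← hpow]; omega), map_zero] at hne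
    exact hne rfl
  rw [HahnSeries.order_pow, nsmul_eq_mul] at h1
  exact pos_of_mul_pos_right h1 (by positivity)

theorem isCoord_contAut (g : contAut 1 R) : IsCoord (g.1 (mono 0 1 1)) := by
  have hnn : ∀ (g : contAut 1 R) (P : Ideal R), P.IsPrime →
      ∀ m ≤ 0, ((g.1 (mono 0 1 1)) 0).coeff m ∈ P := by
    intro g P hP m hm
    obtain ⟨M, hM⟩ := latCont g 1
    refine coeff_mem_of_pow_mem_lattice (n := M.toNat) ?_ hm
    rw [← map_pow, mono_one_pow]
    exact hM _ (mono_mem_lattice 0 (Int.self_le_toNat M) 1)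
  rw [isCoord_iff_forall_prime]
  intro P hP
  refine ⟨hnn g P hP, fun h1 => ?_⟩
  -- Otherwise `g` maps `z`, and hence all series in `z k[[z]]` modulo `P`, into `z^2 k[[z]]`.
  set b := g⁻¹.1 (mono 0 1 1) with hb
  have hgb : g.1 b = mono 0 1 1 := g.1.apply_symm_apply _
  have hz : ((g.1 b) 0).coeff 1 = 1 := by
    rw [hgb, mono_apply_coeff, if_pos ⟨rfl, rfl⟩]
  have hsum := (latCont g).coeff_apply b 1
  apply hP.ne_top
  rw [Ideal.eq_top_iff_one, ← hz]
  refine hsum ▸ finsum_induction (· ∈ P) P.zero_mem (fun _ _ => P.add_mem) fun n => ?_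
  rcases le_or_gt n 0 with h | h
  · exact P.mul_mem_right _ (hnn g⁻¹ P hP n h)
  · obtain ⟨k, rfl⟩ := Int.eq_ofNat_of_zero_le h.le
    refine P.mul_mem_left _ ?_
    rw [← mono_one_pow, map_pow, ← Ideal.Quotient.eq_zero_iff_mem]
    change ((coeffMap 1 (Ideal.Quotient.mk P) (g.1 (mono 0 1 1) ^ k)) 0).coeff 1 = 0
    rw [map_pow]
    have h2 : coeffMap 1 (Ideal.Quotient.mk P) (g.1 (mono 0 1 1)) ∈ lattice 1 (R ⧸ P) 2 := by
      intro i m hm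
      rw [Subsingleton.elim i 0, coeffMap_coeff, Ideal.Quotient.eq_zero_iff_mem]
      rcases eq_or_ne m 1 with rfl | hm1
      · exact h1
      · exact hnn g P hP m (by omega)
    exact (pow_mem_lattice h2 k).1 0 1 (by omega)

end Coordinates

/-! ### Idempotents in rings of Laurent series -/

section Idempotent

variable {R : Type u} [CommRing R]

/-- The derivation `z d/dz` on Laurent series. -/
def eulerDeriv (f : R⸨X⸩) : R⸨X⸩ where
  coeff m := (m : R) * f.coeff m
  isPWO_support' := f.isPWO_support.mono fun _ hm => right_ne_zero_of_mul hm

theorem eulerDeriv_support (f : R⸨X⸩) : (eulerDeriv f).support ⊆ f.support :=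
  fun _ hm => right_ne_zero_of_mul hm

theorem eulerDeriv_mul (f g : R⸨X⸩) :
    eulerDeriv (f * g) = eulerDeriv f * g + f * eulerDeriv g := by
  ext m
  rw [HahnSeries.coeff_add, HahnSeries.coeff_mul_left' f.isPWO_support (eulerDeriv_support f),
    HahnSeries.coeff_mul_right' g.isPWO_support (eulerDeriv_support g), ← Finset.sum_add_distrib]
  change (m : R) * (f * g).coeff m = _
  rw [HahnSeries.coeff_mul, Finset.mul_sum]
  refine Finset.sum_congr rfl fun p hp => ?_
  rw [← (Finset.mem_antidiagonal.1 hp).2.2]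
  change _ = (p.1 : R) * f.coeff p.1 * g.coeff p.2 + f.coeff p.1 * ((p.2 : R) * g.coeff p.2)
  push_cast
  ring

/-- Over a ring which contains the rational numbers, idempotent Laurent series are constant: a
derivation kills every idempotent. -/
theorem coeff_eq_zero_of_isIdempotentElem (hR : ∀ n : ℤ, n ≠ 0 → IsUnit (n : R)) {e : R⸨X⸩}
    (he : e * e = e) {m : ℤ} (hm : m ≠ 0) : e.coeff m = 0 := by
  have h1 : eulerDeriv e = eulerDeriv e * e + e * eulerDeriv e := by
    rw [← eulerDeriv_mul, he]
  have h2 : e * eulerDeriv e = 0 := by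
    have h3 := congrArg (e * ·) h1
    linear_combination (-1 : R⸨X⸩) * h3 - 2 * eulerDeriv e * he
  have h4 : eulerDeriv e = 0 := by
    rw [h1]
    linear_combination 2 * h2
  have h5 : (m : R) * e.coeff m = 0 := congrArg (fun f : R⸨X⸩ => f.coeff m) h4
  exact (hR m hm).mul_right_eq_zero.1 h5

end Idempotent

/-! ### Permutation matrices of idempotents -/

section PermMat

variable {r : ℕ} {R : Type u} [CommRing R]

/-- A matrix whose rows and whose columns are complete systems of orthogonal idempotents. Over a
connected ring these are the permutation matrices; the entry at `(i, j)` describes where the factor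
`i` is sent to the factor `j`. -/
structure IsPermMat (m : Fin r → Fin r → R) : Prop where
  col_mul : ∀ i i' j, i ≠ i' → m i j * m i' j = 0
  col_sum : ∀ j, ∑ i, m i j = 1
  row_mul : ∀ i j j', j ≠ j' → m i j * m i j' = 0
  row_sum : ∀ i, ∑ j, m i j = 1

namespace IsPermMat

variable {m : Fin r → Fin r → R}

theorem transpose (h : IsPermMat m) : IsPermMat fun i j => m j i :=
  ⟨fun _ _ _ => h.row_mul _ _ _, h.row_sum, fun _ _ _ => h.col_mul _ _ _, h.col_sum⟩

theorem mul_self (h : IsPermMat m) (i j : Fin r) : m i j * m i j = m i j := by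
  conv_rhs => rw [← mul_one (m i j), ← h.row_sum i, Finset.mul_sum]
  rw [Finset.sum_eq_single j (fun j' _ hj => h.row_mul i j j' hj.symm) (by simp)]

theorem sum_mul (h : IsPermMat m) (i i' : Fin r) :
    ∑ j, m i j * m i' j = if i = i' then 1 else 0 := by
  split_ifs with hi
  · subst hi
    simp only [h.mul_self, h.row_sum]
  · exact Finset.sum_eq_zero fun j _ => h.col_mul i i' j hi

theorem sum_smul_sum_smul (h : IsPermMat m) (v : V r R) (i : Fin r) :
    ∑ j, m i j • ∑ i', m i' j • v i' = v i := by
  simp only [Finset.smul_sum, smul_smul]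
  rw [Finset.sum_comm]
  simp only [← Finset.sum_smul, h.sum_mul]
  rw [Finset.sum_eq_single i (fun i' _ hi => by rw [if_neg hi.symm, zero_smul]) (by simp),
    if_pos rfl, one_smul]

/-- The automorphism which permutes the factors of `V r R` according to a permutation matrix of
idempotents. -/
def algEquiv (h : IsPermMat m) : V r R ≃ₐ[R] V r R where
  toFun v j := ∑ i, m i j • v i
  invFun v i := ∑ j, m i j • v j
  left_inv v := funext fun i => h.sum_smul_sum_smul v i
  right_inv v := funext fun i => h.transpose.sum_smul_sum_smul v i
  map_mul' v w := by
    funext j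
    rw [Pi.mul_apply, Finset.sum_mul_sum]
    refine Finset.sum_congr rfl fun i _ => ?_
    rw [Finset.sum_eq_single i]
    · rw [smul_mul_smul_comm, h.mul_self, Pi.mul_apply]
    · intro i' _ hi
      rw [smul_mul_smul_comm, h.col_mul i i' j hi.symm, zero_smul]
    · simp
  map_add' v w := by
    funext j
    simp only [Pi.add_apply, smul_add, Finset.sum_add_distrib]
  commutes' c := by
    funext j
    simp only [Pi.algebraMap_apply]
    rw [← Finset.sum_smul, h.col_sum, one_smul]

theorem latCont_algEquiv (h : IsPermMat m) :
    LatCont ((h.algEquiv : V r R →ₐ[R] V r R) : V r R →+ V r R) := by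
  refine fun n => ⟨n, fun v hv j l hl => ?_⟩
  change (∑ i, m i j • v i).coeff l = 0
  rw [HahnSeries.coeff_sum]
  exact Finset.sum_eq_zero fun i _ => by rw [HahnSeries.coeff_smul, hv i l hl, smul_zero]

/-- `algEquiv` as a continuous automorphism. -/
def aut (h : IsPermMat m) : contAut r R :=
  ⟨h.algEquiv,
    (continuous_iff_latCont ((h.algEquiv : V r R →ₐ[R] V r R) : V r R →+ V r R)).2
      h.latCont_algEquiv,
    (continuous_iff_latCont ((h.transpose.algEquiv : V r R →ₐ[R] V r R) : V r R →+ V r R)).2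
      h.transpose.latCont_algEquiv⟩

theorem aut_apply (h : IsPermMat m) (v : V r R) (j : Fin r) : h.aut.1 v j = ∑ i, m i j • v i := rfl

theorem aut_inv (h : IsPermMat m) : h.aut⁻¹ = h.transpose.aut := rfl

theorem aut_mono (h : IsPermMat m) (i : Fin r) (n : ℤ) (c : R) :
    h.aut.1 (mono i n c) = ∑ j, mono j n (m i j * c) := by
  funext j
  ext l
  rw [aut_apply, HahnSeries.coeff_sum, Finset.sum_apply, HahnSeries.coeff_sum,
    Finset.sum_eq_single i, Finset.sum_eq_single j]
  · simp [mono_apply_coeff]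
  · intro j' _ hj
    simp [mono_apply_coeff, hj.symm]
  · simp
  · intro i' _ hi
    simp [mono_apply_coeff, hi]
  · simp

theorem map (h : IsPermMat m) {R' : Type u} [CommRing R'] (f : R →+* R') :
    IsPermMat fun i j => f (m i j) where
  col_mul i i' j hi := by rw [← map_mul, h.col_mul i i' j hi, map_zero]
  col_sum j := by rw [← map_sum, h.col_sum, map_one]
  row_mul i j j' hj := by rw [← map_mul, h.row_mul i j j' hj, map_zero]
  row_sum i := by rw [← map_sum, h.row_sum, map_one]

theorem baseChange_aut (h : IsPermMat m) {R' : Type u} [CommRing R'] (f : R →+* R') :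
    baseChange r f h.aut = (h.map f).aut := by
  refine ext_of_coeffMap f fun v => ?_
  rw [baseChange_coeffMap]
  funext j
  ext l
  rw [coeffMap_coeff, aut_apply, aut_apply, HahnSeries.coeff_sum, HahnSeries.coeff_sum, map_sum]
  exact Finset.sum_congr rfl fun i _ => by
    rw [HahnSeries.coeff_smul, HahnSeries.coeff_smul, smul_eq_mul, smul_eq_mul, map_mul,
      coeffMap_coeff]

end IsPermMat

/-- The automorphism defined by a product of permutation matrices. -/
theorem aut_mul_aut {m m' m'' : Fin r → Fin r → R} (h : IsPermMat m) (h' : IsPermMat m')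
    (h'' : IsPermMat m'') (e : ∀ i l, m'' i l = ∑ j, m' i j * m j l) :
    h.aut * h'.aut = h''.aut := by
  refine Subtype.ext (AlgEquiv.ext fun v => funext fun l => ?_)
  change ∑ j, m j l • ∑ i, m' i j • v i = ∑ i, m'' i l • v i
  simp only [Finset.smul_sum, smul_smul, e, Finset.sum_smul]
  rw [Finset.sum_comm]
  exact Finset.sum_congr rfl fun i _ => Finset.sum_congr rfl fun j _ => by rw [mul_comm]

end PermMat

/-! ### Coordinates on the group of continuous automorphisms -/

section Coordinates

variable {r : ℕ} {R : Type u} [CommRing R]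

/-- The matrix which describes how an automorphism permutes the factors: the component `j` of the
image of the unit of the factor `i` has the constant coefficient `permCoord φ i j`. -/
def permCoord (φ : contAut r R) (i j : Fin r) : R := ((φ.1 (mono i 0 1)) j).coeff 0

theorem permCoord_baseChange {R' : Type u} [CommRing R'] (f : R →+* R') (φ : contAut r R)
    (i j : Fin r) : permCoord (baseChange r f φ) i j = f (permCoord φ i j) := by
  have h := baseChange_coeffMap f φ (mono i 0 1)
  rw [coeffMap_mono, map_one] at h
  rw [permCoord, h]
  rfl

theorem smul_mono_one (i : Fin r) (n : ℤ) (c : R) : c • mono i n (1 : R) = mono i n c := by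
  rw [smul_mono, mul_one]

theorem sum_mono_apply (c : Fin r → R) (n : ℤ) (j : Fin r) :
    (∑ i, mono i n (c i) : V r R) j = HahnSeries.single n (c j) := by
  rw [Finset.sum_apply, Finset.sum_eq_single j]
  · simp [mono]
  · intro i _ hi
    simp [mono, hi.symm]
  · simp

theorem apply_mono_zero (hR : ∀ n : ℤ, n ≠ 0 → IsUnit (n : R)) (φ : contAut r R) (i : Fin r) :
    φ.1 (mono i 0 1) = ∑ j, mono j 0 (permCoord φ i j) := by
  funext j
  rw [sum_mono_apply]
  have he : (φ.1 (mono i 0 1)) j * (φ.1 (mono i 0 1)) j = (φ.1 (mono i 0 1)) j := by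
    rw [← Pi.mul_apply, ← map_mul, mono_mul_mono, add_zero, mul_one]
  ext m
  rw [HahnSeries.coeff_single]
  split_ifs with h
  · rw [h]
    rfl
  · exact coeff_eq_zero_of_isIdempotentElem hR he h

theorem permCoord_eq_of_apply {φ : contAut r R} {i : Fin r} {c : Fin r → R}
    (h : φ.1 (mono i 0 1) = ∑ j, mono j 0 (c j)) (j : Fin r) : permCoord φ i j = c j := by
  rw [permCoord, h, sum_mono_apply, HahnSeries.coeff_single_same]

theorem permCoord_mul (hR : ∀ n : ℤ, n ≠ 0 → IsUnit (n : R)) (φ ψ : contAut r R) (i l : Fin r) :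
    permCoord (φ * ψ) i l = ∑ j, permCoord ψ i j * permCoord φ j l := by
  refine permCoord_eq_of_apply (c := fun l => ∑ j, permCoord ψ i j * permCoord φ j l) ?_ l
  change φ.1 (ψ.1 (mono i 0 1)) = _
  rw [apply_mono_zero hR ψ, map_sum]
  funext l
  rw [sum_mono_apply, Finset.sum_apply]
  ext n
  rw [HahnSeries.coeff_sum]
  have : ∀ j, φ.1 (mono j 0 (permCoord ψ i j)) l = HahnSeries.single 0
      (permCoord ψ i j * permCoord φ j l) := by
    intro j
    rw [← smul_mono_one, map_smul, apply_mono_zero hR φ, Pi.smul_apply, sum_mono_apply]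
    ext n
    simp [HahnSeries.coeff_single]
  simp only [this, HahnSeries.coeff_single]
  split_ifs <;> simp

theorem permCoord_one (i j : Fin r) : permCoord (1 : contAut r R) i j = if i = j then 1 else 0 := by
  change ((mono i 0 1 : V r R) j).coeff 0 = _
  simp [mono_apply_coeff, eq_comm]

theorem permCoord_aut {m : Fin r → Fin r → R} (h : IsPermMat m) (i j : Fin r) :
    permCoord h.aut i j = m i j :=
  permCoord_eq_of_apply (c := m i) (by simp [h.aut_mono]) j

theorem permCoord_col_mul (φ : contAut r R) (hR : ∀ n : ℤ, n ≠ 0 → IsUnit (n : R)) (i i' j : Fin r)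
    (hi : i ≠ i') : permCoord φ i j * permCoord φ i' j = 0 := by
  have h : φ.1 (mono i 0 1) * φ.1 (mono i' 0 1) = 0 := by
    rw [← map_mul, mono_mul_mono_of_ne hi, map_zero]
  rw [apply_mono_zero hR, apply_mono_zero hR] at h
  have h' := congrArg (fun v : V r R => (v j).coeff 0) h
  simp only [Pi.mul_apply] at h'
  rw [sum_mono_apply, sum_mono_apply, HahnSeries.single_mul_single, add_zero,
    HahnSeries.coeff_single_same] at h'
  exact h'

theorem permCoord_col_sum (φ : contAut r R) (j : Fin r) : ∑ i, permCoord φ i j = 1 := by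
  have h : ∑ i, φ.1 (mono i 0 1) = 1 := by rw [← map_sum, ← one_eq_sum_mono, map_one]
  have h' := congrArg (fun v : V r R => (v j).coeff 0) h
  simpa [HahnSeries.coeff_sum, permCoord] using h'

/-- The matrix of the inverse is the transpose. -/
theorem permCoord_inv (hR : ∀ n : ℤ, n ≠ 0 → IsUnit (n : R)) (φ : contAut r R) (i j : Fin r) :
    permCoord φ⁻¹ j i = permCoord φ i j := by
  have key : ∀ (φ : contAut r R) (i j : Fin r),
      permCoord φ i j * permCoord φ⁻¹ j i = permCoord φ⁻¹ j i := by
    intro φ i j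
    have h1 : mono j 0 1 * φ.1 (mono i 0 1) = permCoord φ i j • mono j 0 1 := by
      rw [apply_mono_zero hR, smul_mono_one]
      funext l
      rw [Pi.mul_apply, sum_mono_apply]
      by_cases hl : l = j
      · subst hl
        simp [mono]
      · simp [mono, hl]
    have h2 := congrArg φ.1.symm h1
    rw [map_mul, AlgEquiv.symm_apply_apply, map_smul] at h2
    have h3 := congrArg (fun v : V r R => (v i).coeff 0) h2
    simp only [Pi.mul_apply, Pi.smul_apply, HahnSeries.coeff_smul, smul_eq_mul] at h3
    rw [show (mono i 0 1 : V r R) i = 1 by simp [mono], mul_one] at h3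
    exact h3.symm
  have h1 := key φ i j
  have h2 := key φ⁻¹ j i
  rw [inv_inv] at h2
  rw [← h1, mul_comm, h2]

theorem isPermMat_permCoord (hR : ∀ n : ℤ, n ≠ 0 → IsUnit (n : R)) (φ : contAut r R) :
    IsPermMat (permCoord φ) where
  col_mul := permCoord_col_mul φ hR
  col_sum := permCoord_col_sum φ
  row_mul i j j' hj := by
    rw [← permCoord_inv hR φ i j, ← permCoord_inv hR φ i j']
    exact permCoord_col_mul φ⁻¹ hR j j' i hj
  row_sum i := by
    simp only [← permCoord_inv hR φ]
    exact permCoord_col_sum φ⁻¹ i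

/-- An automorphism which fixes the unit of a factor acts on that factor separately. -/
theorem apply_eq_of_fix {φ : contAut r R} {i : Fin r} (h : φ.1 (mono i 0 1) = mono i 0 1)
    {v w : V r R} (hvw : v i = w i) : φ.1 v i = φ.1 w i := by
  have key : ∀ v : V r R, φ.1 v i = φ.1 (v * mono i 0 1) i := by
    intro v
    rw [map_mul, h, Pi.mul_apply, show (mono i 0 1 : V r R) i = 1 by simp [mono], mul_one]
  rw [key v, key w]
  refine congrArg (fun x => φ.1 x i) ?_
  funext l
  by_cases hl : l = i
  · rw [Pi.mul_apply, Pi.mul_apply, hl, hvw]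
  · simp [mono, hl]

/-- An automorphism which fixes the units of all factors acts factor by factor. -/
theorem exists_diagHom_eq {φ : contAut r R} (h : ∀ i, φ.1 (mono i 0 1) = mono i 0 1) :
    ∃ g, diagHom r R g = φ := by
  have h' : ∀ i, φ⁻¹.1 (mono i 0 1) = mono i 0 1 := fun i => by
    conv_lhs => rw [← h i]
    exact φ.1.symm_apply_apply _
  have hcont : ∀ (φ : contAut r R) (i : Fin r) (A : V 1 R ≃ₐ[R] V 1 R)
      (_ : ∀ v j, A v j = φ.1 (fun _ => v 0) i),
      Continuous[zTopology 1 R, zTopology 1 R] A := by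
    intro φ i A hA
    refine (continuous_iff_latCont ((A : V 1 R →ₐ[R] V 1 R) : V 1 R →+ V 1 R)).2 fun n => ?_
    obtain ⟨m, hm⟩ := latCont φ n
    refine ⟨m, fun v hv j l hl => ?_⟩
    change (A v j).coeff l = 0
    rw [hA]
    exact hm _ (fun _ => hv 0) i l hl
  let g : Fin r → (V 1 R ≃ₐ[R] V 1 R) := fun i =>
    { toFun := fun v _ => φ.1 (fun _ => v 0) i
      invFun := fun v _ => φ⁻¹.1 (fun _ => v 0) i
      left_inv := fun v => funext fun j => by
        refine (apply_eq_of_fix (h' i) (v := fun _ => φ.1 (fun _ => v 0) i)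
          (w := φ.1 fun _ => v 0) rfl).trans ?_
        rw [Subsingleton.elim j 0]
        exact congrFun (φ.1.symm_apply_apply fun _ => v 0) i
      right_inv := fun v => funext fun j => by
        refine (apply_eq_of_fix (h i) (v := fun _ => φ⁻¹.1 (fun _ => v 0) i)
          (w := φ⁻¹.1 fun _ => v 0) rfl).trans ?_
        rw [Subsingleton.elim j 0]
        exact congrFun (φ.1.apply_symm_apply fun _ => v 0) i
      map_mul' := fun v w => funext fun j => congrFun (map_mul φ.1 (fun _ => v 0) fun _ => w 0) i
      map_add' := fun v w => funext fun j => congrFun (map_add φ.1 (fun _ => v 0) fun _ => w 0) i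
      commutes' := fun c => funext fun j => congrFun (φ.1.commutes c) i }
  refine ⟨fun i => ⟨g i, hcont φ i (g i) fun _ _ => rfl, hcont φ⁻¹ i (g i).symm fun _ _ => rfl⟩, ?_⟩
  refine Subtype.ext (AlgEquiv.ext fun v => funext fun i => ?_)
  exact apply_eq_of_fix (h i) rfl

theorem diagHom_mono_zero (g : Fin r → contAut 1 R) (i : Fin r) :
    (diagHom r R g).1 (mono i 0 1) = mono i 0 1 := by
  funext j
  rw [diagHom_apply]
  by_cases hj : j = i
  · subst hj
    have : (fun _ => (mono j 0 1 : V r R) j : V 1 R) = 1 := by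
      funext l
      simp [mono]
    rw [this, map_one]
    simp [mono]
  · have : (fun _ => (mono i 0 1 : V r R) j : V 1 R) = 0 := by
      funext l
      simp [mono, hj]
    rw [this, map_zero]
    simp [mono, hj]

theorem mono_eq_sum_ite (i : Fin r) (n : ℤ) :
    (mono i n 1 : V r R) = ∑ j, mono j n (if i = j then 1 else 0) := by
  funext j
  rw [sum_mono_apply]
  split_ifs with h
  · subst h
    simp [mono]
  · simp [mono, Ne.symm h]

/-- The semidirect product decomposition of the group of automorphisms. -/
theorem exists_eq_aut_mul_diagHom (hR : ∀ n : ℤ, n ≠ 0 → IsUnit (n : R)) (φ : contAut r R) :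
    ∃ g, φ = (isPermMat_permCoord hR φ).aut * diagHom r R g := by
  set h := isPermMat_permCoord hR φ
  obtain ⟨g, hg⟩ := exists_diagHom_eq (φ := h.aut⁻¹ * φ) fun i => by
    rw [apply_mono_zero hR, mono_eq_sum_ite]
    refine Finset.sum_congr rfl fun l _ => congrArg _ ?_
    rw [permCoord_mul hR, h.aut_inv, ← h.sum_mul i l]
    exact Finset.sum_congr rfl fun j _ => by rw [permCoord_aut]
  exact ⟨g, by rw [hg, mul_inv_cancel_left]⟩

theorem permCoord_aut_mul_diagHom {m : Fin r → Fin r → R} (h : IsPermMat m)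
    (g : Fin r → contAut 1 R) (i j : Fin r) : permCoord (h.aut * diagHom r R g) i j = m i j := by
  rw [← permCoord_aut h, permCoord, permCoord]
  change ((h.aut.1 ((diagHom r R g).1 (mono i 0 1))) j).coeff 0 = _
  rw [diagHom_mono_zero]

/-- The series `∑_j φ(z_i)_j`. When `φ` permutes the factors, only one summand is different from
zero, and `φ` acts on the factor `i` by substituting this series for the variable. -/
def seriesCoord (φ : contAut r R) (i : Fin r) : V 1 R := fun _ => ∑ j, φ.1 (mono i 1 1) j

theorem seriesCoord_coeff_baseChange {R' : Type u} [CommRing R'] (f : R →+* R') (φ : contAut r R)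
    (i : Fin r) (n : ℤ) : (seriesCoord (baseChange r f φ) i 0).coeff n
      = f ((seriesCoord φ i 0).coeff n) := by
  have h := baseChange_coeffMap f φ (mono i 1 1)
  rw [coeffMap_mono, map_one] at h
  rw [seriesCoord, h, seriesCoord, HahnSeries.coeff_sum, HahnSeries.coeff_sum, map_sum]
  rfl

theorem seriesCoord_aut_mul_diagHom {m : Fin r → Fin r → R} (h : IsPermMat m)
    (g : Fin r → contAut 1 R) (i : Fin r) :
    seriesCoord (h.aut * diagHom r R g) i = (g i).1 (mono 0 1 1) := by
  have h1 : ∀ l, (diagHom r R g).1 (mono i 1 1) l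
      = if l = i then (g i).1 (mono 0 1 1) 0 else 0 := by
    intro l
    rw [diagHom_apply]
    split_ifs with hl
    · subst hl
      refine congrArg (fun x => (g l).1 x 0) (funext fun j => ?_)
      rw [Subsingleton.elim j 0]
      simp [mono]
    · have : (fun _ => (mono i 1 1 : V r R) l : V 1 R) = 0 := by
        funext j
        simp [mono, hl]
      rw [this, map_zero]
      rfl
  funext l
  rw [Subsingleton.elim l 0]
  change ∑ j, ∑ i', m i' j • (diagHom r R g).1 (mono i 1 1) i' = _
  simp only [h1, smul_ite, smul_zero, Finset.sum_ite_eq', Finset.mem_univ, if_true]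
  rw [← Finset.sum_smul, h.row_sum, one_smul]

theorem isCoord_seriesCoord (hR : ∀ n : ℤ, n ≠ 0 → IsUnit (n : R)) (φ : contAut r R) (i : Fin r) :
    IsCoord (seriesCoord φ i) := by
  obtain ⟨g, hg⟩ := exists_eq_aut_mul_diagHom hR φ
  rw [hg, seriesCoord_aut_mul_diagHom]
  exact isCoord_contAut _

theorem contAut_ext_coord (hR : ∀ n : ℤ, n ≠ 0 → IsUnit (n : R)) {φ ψ : contAut r R}
    (hm : permCoord φ = permCoord ψ) (ha : seriesCoord φ = seriesCoord ψ) : φ = ψ := by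
  obtain ⟨g, hg⟩ := exists_eq_aut_mul_diagHom hR φ
  obtain ⟨g', hg'⟩ := exists_eq_aut_mul_diagHom hR ψ
  have : g = g' := by
    funext i
    apply contAut_one_ext
    rw [← seriesCoord_aut_mul_diagHom (isPermMat_permCoord hR φ), ← hg, ha,
      ← seriesCoord_aut_mul_diagHom (isPermMat_permCoord hR ψ), ← hg']
  rw [hg, hg', this]
  congr 1
  exact Subtype.ext (AlgEquiv.ext fun v => funext fun j => by
    rw [IsPermMat.aut_apply, IsPermMat.aut_apply, hm])

theorem exists_contAut_of_coord {m : Fin r → Fin r → R} (h : IsPermMat m) {a : Fin r → V 1 R}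
    (ha : ∀ i, IsCoord (a i)) : ∃ φ : contAut r R, permCoord φ = m ∧ seriesCoord φ = a := by
  choose g hg using fun i => (ha i).exists_contAut
  exact ⟨h.aut * diagHom r R g, funext fun i => funext fun j => permCoord_aut_mul_diagHom h g i j,
    funext fun i => by rw [seriesCoord_aut_mul_diagHom, hg]⟩

theorem diagHom_injective : Function.Injective (diagHom r R) := by
  intro g g' h
  funext i
  refine Subtype.ext (AlgEquiv.ext fun v => funext fun j => ?_)
  have h1 := congrFun (congrArg (fun φ : contAut r R => φ.1 fun _ => v 0) h) i
  simp only [diagHom_apply] at h1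
  rw [Subsingleton.elim j 0]
  have hv : (fun _ => v 0) = v := funext fun l => by rw [Subsingleton.elim l 0]
  rwa [hv] at h1

end Coordinates

/-! ### Idempotent global sections of a scheme -/

section Sections

variable {X : Scheme.{u}}

theorem isUnit_of_forall_evaluation_ne_zero {x : Γ(X, ⊤)} (h : ∀ s, X.Γevaluation s x ≠ 0) :
    IsUnit x :=
  X.toRingedSpace.isUnit_of_isUnit_germ ⊤ x fun s _ =>
    (IsLocalRing.residue_ne_zero_iff_isUnit _).1 (h s)

/-- Idempotent sections are determined by their values at points. -/
theorem eq_of_forall_evaluation_eq {x y : Γ(X, ⊤)} (hx : x * x = x) (hy : y * y = y)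
    (h : ∀ s, X.Γevaluation s x = X.Γevaluation s y) : x = y := by
  -- The difference `d` satisfies `d ^ 3 = d`, and `1 - d ^ 2` does not vanish anywhere.
  have hu : IsUnit (1 - (x - y) * (x - y)) := by
    refine isUnit_of_forall_evaluation_ne_zero fun s => ?_
    rw [map_sub, map_mul, map_sub, h s, sub_self, mul_zero, sub_zero, map_one]
    exact one_ne_zero
  have h0 : (1 - (x - y) * (x - y)) * (x - y) = 0 := by
    linear_combination (-x - 1 + 3 * y) * hx + (y + 1 - 3 * x) * hy
  exact sub_eq_zero.1 (hu.mul_right_eq_zero.1 h0)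

/-- The indicator function of an open and closed subset of a scheme, as a global section. -/
theorem exists_indicator (U : Set X) (hU : IsClopen U) :
    ∃ e : Γ(X, ⊤), e * e = e ∧ ∀ s, (s ∈ U → X.Γevaluation s e = 1) ∧
      (s ∉ U → X.Γevaluation s e = 0) := by
  let W : Bool → X.Opens := fun b => bif b then ⟨U, hU.2⟩ else ⟨Uᶜ, hU.compl.2⟩
  have hcov : (⊤ : X.Opens) ≤ iSup W := by
    intro s _
    rw [TopologicalSpace.Opens.mem_iSup]
    by_cases h : s ∈ U
    exacts [⟨true, h⟩, ⟨false, h⟩]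
  let sf : ∀ b, Γ(X, W b) := fun b => if b then 1 else 0
  have hcomp : TopCat.Presheaf.IsCompatible X.presheaf W sf := by
    have hbot : ∀ b c, b ≠ c → Subsingleton Γ(X, W b ⊓ W c) := by
      intro b c hbc
      have : W b ⊓ W c = ⊥ := by
        ext s
        cases b <;> cases c <;> simp_all [W]
      rw [this]
      infer_instance
    intro b c
    by_cases hbc : b = c
    · subst hbc
      rfl
    · exact (hbot b c hbc).elim _ _
  obtain ⟨e, he, huniq⟩ : ∃ e : Γ(X, ⊤),
      (∀ b, X.presheaf.map (homOfLE (le_top : W b ≤ ⊤)).op e = sf b) ∧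
      ∀ e' : Γ(X, ⊤), (∀ b, X.presheaf.map (homOfLE (le_top : W b ≤ ⊤)).op e' = sf b) → e' = e :=
    X.sheaf.existsUnique_gluing' W ⊤ (fun b => homOfLE le_top) hcov sf hcomp
  have heval : ∀ s b (hs : s ∈ W b), X.Γevaluation s e = X.evaluation (W b) s hs (sf b) := by
    intro s b hs
    rw [← he b]
    refine congrArg (X.residue s) ?_
    exact (X.presheaf.germ_res_apply (homOfLE (le_top : W b ≤ ⊤)) s hs e).symm
  refine ⟨e, huniq _ fun b => ?_, fun s => ⟨fun hs => ?_, fun hs => ?_⟩⟩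
  · rw [map_mul, he]
    cases b <;> simp [sf]
  · rw [heval s true hs]
    exact map_one _
  · rw [heval s false hs]
    exact map_zero _

/-- A matrix of sections which takes the value of a permutation matrix at every point. -/
def HasPermValues {r : ℕ} (m : Fin r → Fin r → Γ(X, ⊤)) (σ : X → Equiv.Perm (Fin r)) : Prop :=
  ∀ s i j, X.Γevaluation s (m i j) = if σ s i = j then 1 else 0

end Sections

section Perm

variable {r : ℕ}

theorem IsPermMat.exists_perm {K : Type u} [Field K] {m : Fin r → Fin r → K} (h : IsPermMat m) :
    ∃ σ : Equiv.Perm (Fin r), ∀ i j, m i j = if σ i = j then 1 else 0 := by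
  have hex : ∀ i, ∃ j, m i j ≠ 0 := by
    intro i
    by_contra! hall
    have := h.row_sum i
    simp [hall] at this
  choose f hf using hex
  have hinj : Function.Injective f := by
    intro i i' hii
    by_contra hne
    have := h.col_mul i i' (f i) hne
    rcases mul_eq_zero.1 this with h0 | h0
    · exact hf i h0
    · exact hf i' (hii ▸ h0)
  refine ⟨Equiv.ofBijective f (Finite.injective_iff_bijective.1 hinj), fun i j => ?_⟩
  rw [Equiv.ofBijective_apply]
  split_ifs with hj
  · subst hj
    exact mul_left_cancel₀ (hf i) ((h.mul_self i _).trans (mul_one _).symm)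
  · exact (mul_eq_zero.1 (h.row_mul i (f i) j hj)).resolve_left (hf i)

variable {X : Scheme.{u}} {m : Fin r → Fin r → Γ(X, ⊤)}

theorem HasPermValues.unique {σ τ : X → Equiv.Perm (Fin r)} (h : HasPermValues m σ)
    (h' : HasPermValues m τ) : σ = τ := by
  refine funext fun s => Equiv.ext fun i => ?_
  have h1 := h s i (σ s i)
  rw [h' s i (σ s i), if_pos rfl] at h1
  by_contra hne
  rw [if_neg (Ne.symm hne)] at h1
  exact zero_ne_one h1

/-- The permutation is constant on the intersection of the open sets where the entries `m i (σ s i)`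
do not vanish. -/
theorem IsPermMat.exists_hasPermValues (h : IsPermMat m) :
    ∃ σ : LocallyConstant X (Equiv.Perm (Fin r)), HasPermValues m σ := by
  choose σ hσ using fun s => (h.map (X.Γevaluation s).hom).exists_perm
  refine ⟨⟨σ, (IsLocallyConstant.iff_exists_open _).2 fun s => ?_⟩, hσ⟩
  refine ⟨⋂ i, (X.basicOpen (m i (σ s i)) : Set X), isOpen_iInter_of_finite fun i =>
    (X.basicOpen _).2, Set.mem_iInter.2 fun i => ?_, fun t ht => Equiv.ext fun i => ?_⟩
  · refine (X.evaluation_ne_zero_iff_mem_basicOpen s (TopologicalSpace.Opens.mem_top s) _).1 ?_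
    have : X.Γevaluation s (m i (σ s i)) = 1 := (hσ s i _).trans (if_pos rfl)
    rw [this]
    exact one_ne_zero
  · have h1 := (X.evaluation_ne_zero_iff_mem_basicOpen t (TopologicalSpace.Opens.mem_top t) _).2
      (Set.mem_iInter.1 ht i)
    by_contra hne
    exact h1 ((hσ t i _).trans (if_neg hne))

/-- The entry at `(i, j)` is the indicator function of the locus where `σ` sends `i` to `j`. -/
theorem exists_isPermMat (σ : LocallyConstant X (Equiv.Perm (Fin r))) :
    ∃ m : Fin r → Fin r → Γ(X, ⊤), IsPermMat m ∧ HasPermValues m σ := by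
  have hclopen : ∀ i j, IsClopen {s : X | σ s i = j} := fun i j =>
    ⟨isOpen_compl_iff.1 (σ.isLocallyConstant {τ | τ i = j}ᶜ), σ.isLocallyConstant {τ | τ i = j}⟩
  choose m hidem hval using fun i j => exists_indicator _ (hclopen i j)
  have hm : HasPermValues m σ := by
    intro s i j
    split_ifs with h
    exacts [(hval i j s).1 h, (hval i j s).2 h]
  have h0 : (0 : Γ(X, ⊤)) * 0 = 0 := mul_zero _
  have h1 : (1 : Γ(X, ⊤)) * 1 = 1 := mul_one _
  have hmul : ∀ i j i' j', (m i j * m i' j') * (m i j * m i' j') = m i j * m i' j' := by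
    intro i j i' j'
    rw [mul_mul_mul_comm, hidem, hidem]
  have hcol : ∀ i i' j, i ≠ i' → m i j * m i' j = 0 := by
    refine fun i i' j hi => eq_of_forall_evaluation_eq (hmul _ _ _ _) h0 fun s => ?_
    rw [map_mul, hm, hm, map_zero]
    split_ifs with h h'
    · exact absurd ((σ s).injective (h.trans h'.symm)) hi
    all_goals simp
  have hrow : ∀ i j j', j ≠ j' → m i j * m i j' = 0 := by
    refine fun i j j' hj => eq_of_forall_evaluation_eq (hmul _ _ _ _) h0 fun s => ?_
    rw [map_mul, hm, hm, map_zero]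
    split_ifs with h h'
    · exact absurd (h.symm.trans h') hj
    all_goals simp
  have hsum : ∀ f : Fin r → Γ(X, ⊤), (∀ i, f i * f i = f i) → (∀ i j, i ≠ j → f i * f j = 0) →
      (∑ i, f i) * (∑ i, f i) = ∑ i, f i := by
    intro f hf hf'
    rw [Finset.sum_mul_sum]
    refine Finset.sum_congr rfl fun i _ => ?_
    rw [Finset.sum_eq_single i (fun j _ hj => hf' i j hj.symm) (by simp), hf]
  refine ⟨m, ⟨hcol, fun j => ?_, hrow, fun i => ?_⟩, hm⟩
  · refine eq_of_forall_evaluation_eq (hsum _ (fun i => hidem i j) fun i i' => hcol i i' j) h1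
      fun s => ?_
    simp only [map_sum, hm s, map_one, ← Equiv.eq_symm_apply]
    simp
  · refine eq_of_forall_evaluation_eq (hsum _ (fun j => hidem i j) fun j j' => hrow i j j') h1
      fun s => ?_
    simp [map_sum, hm s]

/-- A permutation matrix is determined by its values. -/
theorem IsPermMat.eq_of_hasPermValues {m' : Fin r → Fin r → Γ(X, ⊤)} {σ : X → Equiv.Perm (Fin r)}
    (h : IsPermMat m) (h' : IsPermMat m') (hm : HasPermValues m σ) (hm' : HasPermValues m' σ) :
    m = m' :=
  funext fun i => funext fun j => eq_of_forall_evaluation_eq (h.mul_self i j) (h'.mul_self i j)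
    fun s => by rw [hm, hm']

theorem HasPermValues.comp {Y : Scheme.{u}} {σ : X → Equiv.Perm (Fin r)} (h : HasPermValues m σ)
    (f : Y ⟶ X) : HasPermValues (fun i j => f.appTop.hom (m i j)) (σ ∘ f) := by
  intro s i j
  refine (Scheme.Γevaluation_naturality_apply f s (m i j)).symm.trans ?_
  rw [h]
  split_ifs with h1 h2 h2
  · exact map_one _
  · exact absurd h1 h2
  · exact absurd h2 h1
  · exact map_zero _

theorem HasPermValues.mul {m' m'' : Fin r → Fin r → Γ(X, ⊤)} {σ σ' : X → Equiv.Perm (Fin r)}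
    (h : HasPermValues m σ) (h' : HasPermValues m' σ')
    (e : ∀ i l, m'' i l = ∑ j, m' i j * m j l) : HasPermValues m'' (σ * σ') := by
  intro s i l
  simp only [e, map_sum, map_mul, h s, h' s, Equiv.Perm.mul_apply, Pi.mul_apply]
  rw [Finset.sum_eq_single (σ' s i) (fun j _ hj => by rw [if_neg hj.symm, zero_mul]) (by simp),
    if_pos rfl, one_mul]
  rfl

theorem hasPermValues_one :
    HasPermValues (X := X) (fun i j : Fin r => if i = j then 1 else 0) 1 := by
  intro s i j
  change X.Γevaluation s (if i = j then 1 else 0) = if i = j then 1 else 0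
  split_ifs
  exacts [map_one (X.Γevaluation s).hom, map_zero (X.Γevaluation s).hom]

theorem isPermMat_one {R : Type u} [CommRing R] :
    IsPermMat (fun i j : Fin r => if i = j then (1 : R) else 0) where
  col_mul i i' j hi := by
    split_ifs with h h'
    · exact absurd (h.trans h'.symm) hi
    all_goals simp
  col_sum j := by simp
  row_mul i j j' hj := by
    split_ifs with h h'
    · exact absurd (h.symm.trans h') hj
    all_goals simp
  row_sum i := by simp

/-- The product of permutation matrices is the matrix of the product of their automorphisms. -/
theorem IsPermMat.mul {R : Type u} [CommRing R] {m m' : Fin r → Fin r → R} (h : IsPermMat m)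
    (h' : IsPermMat m') (hR : ∀ n : ℤ, n ≠ 0 → IsUnit (n : R)) :
    IsPermMat fun i l => ∑ j, m' i j * m j l := by
  have e : permCoord (h.aut * h'.aut) = fun i l => ∑ j, m' i j * m j l :=
    funext fun i => funext fun l => by
      rw [permCoord_mul hR]
      exact Finset.sum_congr rfl fun j _ => by rw [permCoord_aut, permCoord_aut]
  exact e ▸ isPermMat_permCoord hR _

end Perm

/-! ### The permutation of the factors -/

section PermHom

variable {r : ℕ} {X Y : Scheme.{u}} (hX : ∀ n : ℤ, n ≠ 0 → IsUnit (n : Γ(X, ⊤)))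

/-- The permutation of the factors by an automorphism, as a locally constant function. -/
def permFun (φ : contAut r Γ(X, ⊤)) : LocallyConstant X (Equiv.Perm (Fin r)) :=
  (isPermMat_permCoord hX φ).exists_hasPermValues.choose

theorem hasPermValues_permFun (φ : contAut r Γ(X, ⊤)) :
    HasPermValues (permCoord φ) (permFun hX φ) :=
  (isPermMat_permCoord hX φ).exists_hasPermValues.choose_spec

theorem permFun_eq {φ : contAut r Γ(X, ⊤)} {σ : LocallyConstant X (Equiv.Perm (Fin r))}
    (h : HasPermValues (permCoord φ) σ) : permFun hX φ = σ :=
  DFunLike.coe_injective ((hasPermValues_permFun hX φ).unique h)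

/-- `permFun` as a homomorphism. -/
def permHom : contAut r Γ(X, ⊤) →* LocallyConstant X (Equiv.Perm (Fin r)) where
  toFun := permFun hX
  map_one' := permFun_eq hX (by
    have e : permCoord (1 : contAut r Γ(X, ⊤)) = fun i j => if i = j then 1 else 0 :=
      funext fun i => funext fun j => permCoord_one i j
    rw [e]
    exact hasPermValues_one)
  map_mul' φ ψ := permFun_eq hX ((hasPermValues_permFun hX φ).mul (hasPermValues_permFun hX ψ)
    (permCoord_mul hX φ ψ))

theorem permFun_baseChange (hY : ∀ n : ℤ, n ≠ 0 → IsUnit (n : Γ(Y, ⊤))) (f : Y ⟶ X)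
    (φ : contAut r Γ(X, ⊤)) : permFun hY (baseChange r f.appTop.hom φ)
      = (permFun hX φ).comap ⟨f, f.continuous⟩ := by
  refine permFun_eq hY ?_
  have e : permCoord (baseChange r f.appTop.hom φ) = fun i j => f.appTop.hom (permCoord φ i j) :=
    funext fun i => funext fun j => permCoord_baseChange _ _ _ _
  rw [e]
  exact (hasPermValues_permFun hX φ).comp f

/-- The matrix of a locally constant family of permutations. -/
def permMat (σ : LocallyConstant X (Equiv.Perm (Fin r))) : Fin r → Fin r → Γ(X, ⊤) :=
  (exists_isPermMat σ).choose

theorem isPermMat_permMat (σ : LocallyConstant X (Equiv.Perm (Fin r))) : IsPermMat (permMat σ) :=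
  (exists_isPermMat σ).choose_spec.1

theorem hasPermValues_permMat (σ : LocallyConstant X (Equiv.Perm (Fin r))) :
    HasPermValues (permMat σ) σ :=
  (exists_isPermMat σ).choose_spec.2

theorem aut_congr {R : Type u} [CommRing R] {m m' : Fin r → Fin r → R} (h : IsPermMat m)
    (h' : IsPermMat m') (e : m = m') : h.aut = h'.aut := by
  subst e
  rfl

/-- The automorphisms of `V` which permute the factors. -/
def permAutHom : LocallyConstant X (Equiv.Perm (Fin r)) →* contAut r Γ(X, ⊤) :=
  MonoidHom.mk' (fun σ => (isPermMat_permMat σ).aut) fun σ τ => by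
    have h := (isPermMat_permMat σ).mul (isPermMat_permMat τ) hX
    refine Eq.trans ?_ (aut_mul_aut _ _ h fun _ _ => rfl).symm
    exact aut_congr _ _ ((isPermMat_permMat _).eq_of_hasPermValues h (hasPermValues_permMat _)
      ((hasPermValues_permMat σ).mul (hasPermValues_permMat τ) fun _ _ => rfl))

theorem permAutHom_comap (hY : ∀ n : ℤ, n ≠ 0 → IsUnit (n : Γ(Y, ⊤))) (f : Y ⟶ X)
    (σ : LocallyConstant X (Equiv.Perm (Fin r))) :
    permAutHom hY (σ.comap ⟨f, f.continuous⟩) = baseChange r f.appTop.hom (permAutHom hX σ) := by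
  refine Eq.trans ?_ ((isPermMat_permMat σ).baseChange_aut f.appTop.hom).symm
  exact aut_congr _ _ ((isPermMat_permMat _).eq_of_hasPermValues ((isPermMat_permMat σ).map _)
    (hasPermValues_permMat _) ((hasPermValues_permMat σ).comp f))

theorem permFun_permAutHom (σ : LocallyConstant X (Equiv.Perm (Fin r))) :
    permFun hX (permAutHom hX σ) = σ := by
  refine permFun_eq hX ?_
  have e : permCoord (permAutHom hX σ) = permMat σ :=
    funext fun i => funext fun j => permCoord_aut (isPermMat_permMat σ) i j
  rw [e]
  exact hasPermValues_permMat σ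

theorem permFun_diagHom (g : Fin r → contAut 1 Γ(X, ⊤)) : permFun hX (diagHom r _ g) = 1 := by
  refine permFun_eq hX ?_
  have e : permCoord (diagHom r _ g) = fun i j => if i = j then 1 else 0 :=
    funext fun i => funext fun j => by
      rw [← permCoord_one, permCoord, permCoord, diagHom_mono_zero]
      rfl
  rw [e]
  exact hasPermValues_one

/-- The kernel of the homomorphism to permutations consists of the automorphisms which act factor
by factor. -/
theorem range_diagHom : (diagHom r Γ(X, ⊤)).range = (permHom hX).ker := by
  refine le_antisymm ?_ fun φ hφ => ?_
  · rintro _ ⟨g, rfl⟩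
    exact permFun_diagHom hX g
  · have h1 : HasPermValues (permCoord φ) (1 : X → Equiv.Perm (Fin r)) := by
      have := hasPermValues_permFun hX φ
      rwa [show permFun hX φ = 1 from hφ] at this
    have e := (isPermMat_permCoord hX φ).eq_of_hasPermValues isPermMat_one h1 hasPermValues_one
    refine exists_diagHom_eq fun i => ?_
    rw [apply_mono_zero hX, e, mono_eq_sum_ite]

end PermHom

/-- The ideals of the factors over a field are permuted as the entries of the permutation matrix
prescribe. -/
theorem map_factorIdeal {r : ℕ} {K : Type u} [Field K] (hK : ∀ n : ℤ, n ≠ 0 → IsUnit (n : K))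
    (φ : contAut r K) (i l : Fin r) (h : ∀ j, permCoord φ i j = if l = j then 1 else 0) :
    Ideal.map φ.1 (factorIdeal r K i) = factorIdeal r K l := by
  have hspan : ∀ j : Fin r, factorIdeal r K j = Ideal.span {mono j 0 1} := by
    intro j
    refine le_antisymm ((Ideal.span_singleton_le_span_singleton).2 ?_)
      ((Ideal.span_singleton_le_span_singleton).2 ?_)
    · exact ⟨mono j 1 1, by rw [mono_mul_mono, zero_add, mul_one]⟩
    · exact ⟨mono j (-1) 1, by rw [mono_mul_mono, add_neg_cancel, mul_one]⟩
  rw [hspan, hspan, Ideal.map_span, Set.image_singleton, apply_mono_zero hK, mono_eq_sum_ite l]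
  simp only [h]

/-! ### The equations for the coordinates of an automorphism -/

section Points

/-- The indices of the coordinates of an automorphism: the entries of the permutation matrix, the
coefficients of the series `a_i`, and the inverses of the coefficients of `z` in `a_i`. -/
abbrev CoordIndex (r : ℕ) : Type := (Fin r × Fin r) ⊕ (Fin r × ℤ) ⊕ Fin r

variable {r : ℕ} {R : Type u} [CommRing R]

/-- The entries of the permutation matrix. -/
abbrev matPart (x : CoordIndex r → R) (i j : Fin r) : R := x (Sum.inl (i, j))

/-- The coefficients of the series. -/
abbrev serPart (x : CoordIndex r → R) (i : Fin r) (l : ℤ) : R := x (Sum.inr (Sum.inl (i, l)))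

/-- The inverses of the coefficients of `z`. -/
abbrev invPart (x : CoordIndex r → R) (i : Fin r) : R := x (Sum.inr (Sum.inr i))

/-- The families which are coordinates of automorphisms, with the order of the poles and the order
of nilpotency of the coefficients at non-positive exponents bounded in terms of `n`. -/
structure IsPoint (n : ℕ) (x : CoordIndex r → R) : Prop where
  isPermMat : IsPermMat (matPart x)
  pole : ∀ i, ∀ l < -(n : ℤ), serPart x i l = 0
  nil : ∀ i, ∀ l ≤ 0, serPart x i l ^ (n + 1) = 0
  inv : ∀ i, serPart x i 1 * invPart x i = 1

theorem IsPoint.mono {n n' : ℕ} (h : n ≤ n') {x : CoordIndex r → R} (hx : IsPoint n x) :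
    IsPoint n' x where
  isPermMat := hx.isPermMat
  pole i l hl := hx.pole i l (by omega)
  nil i l hl := pow_eq_zero_of_le (by omega) (hx.nil i l hl)
  inv := hx.inv

theorem IsPoint.map {R' : Type u} [CommRing R'] {n : ℕ} {x : CoordIndex r → R} (hx : IsPoint n x)
    (f : R →+* R') : IsPoint n (f ∘ x) where
  isPermMat := hx.isPermMat.map f
  pole i l hl := (congrArg f (hx.pole i l hl)).trans (map_zero f)
  nil i l hl := by
    have := congrArg f (hx.nil i l hl)
    rwa [map_pow, map_zero] at this
  inv i := by
    have := congrArg f (hx.inv i)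
    rwa [map_mul, map_one] at this

/-- The relation between an automorphism and its family of coordinates. -/
structure HasCoords (φ : contAut r R) (x : CoordIndex r → R) : Prop where
  mat : ∀ i j, permCoord φ i j = matPart x i j
  ser : ∀ i l, (seriesCoord φ i 0).coeff l = serPart x i l
  inv : ∀ i, serPart x i 1 * invPart x i = 1

theorem HasCoords.unique {φ : contAut r R} {x y : CoordIndex r → R} (hx : HasCoords φ x)
    (hy : HasCoords φ y) : x = y := by
  have hser : ∀ i l, serPart x i l = serPart y i l := fun i l => by rw [← hx.ser, ← hy.ser]
  funext v
  rcases v with ⟨i, j⟩ | ⟨i, l⟩ | i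
  · exact (hx.mat i j).symm.trans (hy.mat i j)
  · exact hser i l
  · have h1 := hx.inv i
    have h2 := hy.inv i
    rw [hser] at h1
    calc invPart x i = invPart x i * (serPart y i 1 * invPart y i) := by rw [h2, mul_one]
      _ = (serPart y i 1 * invPart x i) * invPart y i := by ring
      _ = invPart y i := by rw [h1, one_mul]

theorem HasCoords.eq (hR : ∀ n : ℤ, n ≠ 0 → IsUnit (n : R)) {φ ψ : contAut r R}
    {x : CoordIndex r → R} (hφ : HasCoords φ x) (hψ : HasCoords ψ x) : φ = ψ := by
  refine contAut_ext_coord hR (funext fun i => funext fun j => by rw [hφ.mat, hψ.mat])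
    (funext fun i => funext fun j => ?_)
  rw [Subsingleton.elim j 0]
  ext l
  rw [hφ.ser, hψ.ser]

theorem HasCoords.map {R' : Type u} [CommRing R'] {φ : contAut r R} {x : CoordIndex r → R}
    (h : HasCoords φ x) (f : R →+* R') : HasCoords (baseChange r f φ) (f ∘ x) where
  mat i j := by rw [permCoord_baseChange, h.mat]; rfl
  ser i l := by rw [seriesCoord_coeff_baseChange, h.ser]; rfl
  inv i := by
    change f (serPart x i 1) * f (invPart x i) = 1
    rw [← map_mul, h.inv, map_one]

theorem IsPoint.exists_hasCoords {n : ℕ} {x : CoordIndex r → R} (hx : IsPoint n x) :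
    ∃ φ, HasCoords φ x := by
  let a : Fin r → V 1 R := fun i _ => HahnSeries.ofSuppBddBelow (serPart x i)
    ⟨-n, fun l hl => not_lt.1 fun h => hl (hx.pole i l h)⟩
  obtain ⟨φ, hm, ha⟩ := exists_contAut_of_coord hx.isPermMat (a := a) fun i =>
    ⟨fun l hl => ⟨n + 1, hx.nil i l hl⟩, IsUnit.of_mul_eq_one _ (hx.inv i)⟩
  exact ⟨φ, fun i j => by rw [hm], fun i l => by rw [ha]; rfl, hx.inv⟩

/-- The coordinates of an automorphism satisfy some bound, because there are only finitely many
coefficients at non-positive exponents. -/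
theorem exists_isPoint_hasCoords (hR : ∀ n : ℤ, n ≠ 0 → IsUnit (n : R)) (φ : contAut r R) :
    ∃ n x, IsPoint n x ∧ HasCoords φ x := by
  have hcoord := isCoord_seriesCoord hR φ
  choose b hb using fun i => (hcoord i).2.exists_right_inv
  choose L hL using fun i => exists_mem_lattice (seriesCoord φ i)
  choose k hk using fun p : Fin r × ℤ => show ∃ k, p.2 ≤ 0 → (seriesCoord φ p.1 0).coeff p.2 ^ k = 0
    by
      by_cases h : p.2 ≤ 0
      · obtain ⟨k, hk⟩ := (hcoord p.1).1 p.2 h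
        exact ⟨k, fun _ => hk⟩
      · exact ⟨0, fun h' => absurd h' h⟩
  let N := ∑ i, (-L i).toNat
  have hN : ∀ i, -(N : ℤ) ≤ L i := by
    intro i
    have := Finset.single_le_sum (f := fun i => (-L i).toNat) (fun _ _ => Nat.zero_le _)
      (Finset.mem_univ i)
    change (-L i).toNat ≤ N at this
    omega
  -- The sum of the orders of nilpotency of the finitely many coefficients which may not vanish.
  let K := ∑ p ∈ Finset.univ ×ˢ Finset.Icc (-(N : ℤ)) 0, k p
  let x : CoordIndex r → R := fun v => match v with
    | Sum.inl p => permCoord φ p.1 p.2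
    | Sum.inr (Sum.inl p) => (seriesCoord φ p.1 0).coeff p.2
    | Sum.inr (Sum.inr i) => b i
  refine ⟨N + K, x, ⟨isPermMat_permCoord hR φ, fun i l hl => ?_, fun i l hl => ?_, hb⟩,
    fun _ _ => rfl, fun _ _ => rfl, hb⟩
  · exact hL i 0 l (by have := hN i; push_cast at hl; omega)
  · by_cases h : -(N : ℤ) ≤ l
    · refine pow_eq_zero_of_le (m := k (i, l)) ?_ (hk (i, l) hl)
      have := Finset.single_le_sum (f := k) (fun _ _ => Nat.zero_le _)
        (show (i, l) ∈ Finset.univ ×ˢ Finset.Icc (-(N : ℤ)) 0 by simp [h, hl])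
      change k (i, l) ≤ K at this
      omega
    · refine pow_eq_zero_of_le (m := 1) (by omega) ?_
      rw [pow_one]
      exact hL i 0 l (by have := hN i; omega)

/-- Only finitely many of the coefficients at non-positive exponents do not vanish, and these are
nilpotent; modulo the ideal which they generate all bounds are satisfied. -/
theorem IsPoint.exists_nilpotent_ideal {n' : ℕ} {x : CoordIndex r → R} (hx : IsPoint n' x) (n : ℕ) :
    ∃ I : Ideal R, IsNilpotent I ∧ IsPoint n fun v => Ideal.Quotient.mk I (x v) := by
  classical
  let F : Finset R := (Finset.univ ×ˢ Finset.Icc (-(n' : ℤ)) 0).image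
    fun p => serPart x p.1 p.2
  have hI : ∀ i, ∀ l ≤ 0, Ideal.Quotient.mk (Ideal.span (F : Set R)) (serPart x i l) = 0 := by
    intro i l hl
    rw [Ideal.Quotient.eq_zero_iff_mem]
    by_cases hl' : -(n' : ℤ) ≤ l
    · exact Ideal.subset_span (Finset.mem_coe.2 (Finset.mem_image.2
        ⟨(i, l), by simp [hl, hl'], rfl⟩))
    · rw [hx.pole i l (not_le.1 hl')]
      exact Ideal.zero_mem _
  have hx' := hx.map (Ideal.Quotient.mk (Ideal.span (F : Set R)))
  refine ⟨Ideal.span (F : Set R), ?_, hx'.isPermMat, fun i l hl => hI i l (by omega),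
    fun i l hl => ?_, hx'.inv⟩
  · rw [Ideal.FG.isNilpotent_iff_le_nilradical ⟨_, rfl⟩, Ideal.span_le]
    intro c hc
    obtain ⟨p, hp, rfl⟩ := Finset.mem_image.1 (Finset.mem_coe.1 hc)
    simp only [Finset.mem_product, Finset.mem_Icc] at hp
    exact ⟨n' + 1, hx.nil _ _ hp.2.2⟩
  · change (Ideal.Quotient.mk _ (serPart x i l)) ^ (n + 1) = 0
    rw [hI i l hl, zero_pow (Nat.succ_ne_zero n)]

end Points

/-! ### The coordinate rings of the approximating schemes -/

section CoordRing

variable (k : Type u) [Field k] (r : ℕ)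

/-- The equations of `IsPoint n`. -/
def relations (n : ℕ) : Set (MvPolynomial (CoordIndex r) k) :=
  let x : CoordIndex r → MvPolynomial (CoordIndex r) k := MvPolynomial.X
  {f | (∃ i i' j, i ≠ i' ∧ f = matPart x i j * matPart x i' j) ∨
    (∃ j, f = ∑ i, matPart x i j - 1) ∨
    (∃ i j j', j ≠ j' ∧ f = matPart x i j * matPart x i j') ∨
    (∃ i, f = ∑ j, matPart x i j - 1) ∨
    (∃ i, ∃ l < -(n : ℤ), f = serPart x i l) ∨
    (∃ i, ∃ l ≤ (0 : ℤ), f = serPart x i l ^ (n + 1)) ∨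
    ∃ i, f = serPart x i 1 * invPart x i - 1}

/-- The ideal generated by the equations of `IsPoint n`. -/
def relIdeal (n : ℕ) : Ideal (MvPolynomial (CoordIndex r) k) := Ideal.span (relations k r n)

variable {k r}

/-- Homomorphisms from the coordinate ring correspond to families which satisfy the equations. -/
theorem relIdeal_le_ker_iff {R : Type u} [CommRing R] {n : ℕ}
    (f : MvPolynomial (CoordIndex r) k →+* R) :
    relIdeal k r n ≤ RingHom.ker f ↔ IsPoint n fun v => f (MvPolynomial.X v) := by
  rw [relIdeal, Ideal.span_le]
  constructor
  · intro h
    have h' : ∀ p ∈ relations k r n, f p = 0 := fun p hp => h hp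
    refine ⟨⟨fun i i' j hi => ?_, fun j => ?_, fun i j j' hj => ?_, fun i => ?_⟩,
      fun i l hl => ?_, fun i l hl => ?_, fun i => ?_⟩
    · simpa using h' _ (Or.inl ⟨i, i', j, hi, rfl⟩)
    · simpa [sub_eq_zero] using h' _ (Or.inr (Or.inl ⟨j, rfl⟩))
    · simpa using h' _ (Or.inr (Or.inr (Or.inl ⟨i, j, j', hj, rfl⟩)))
    · simpa [sub_eq_zero] using h' _ (Or.inr (Or.inr (Or.inr (Or.inl ⟨i, rfl⟩))))
    · exact h' _ (Or.inr (Or.inr (Or.inr (Or.inr (Or.inl ⟨i, l, hl, rfl⟩)))))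
    · rw [← map_pow]
      exact h' _ (Or.inr (Or.inr (Or.inr (Or.inr (Or.inr (Or.inl ⟨i, l, hl, rfl⟩))))))
    · simpa [sub_eq_zero] using
        h' _ (Or.inr (Or.inr (Or.inr (Or.inr (Or.inr (Or.inr ⟨i, rfl⟩))))))
  · intro h p hp
    rw [SetLike.mem_coe, RingHom.mem_ker]
    rcases hp with ⟨i, i', j, hi, rfl⟩ | ⟨j, rfl⟩ | ⟨i, j, j', hj, rfl⟩ | ⟨i, rfl⟩ |
      ⟨i, l, hl, rfl⟩ | ⟨i, l, hl, rfl⟩ | ⟨i, rfl⟩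
    · rw [map_mul]
      exact h.isPermMat.col_mul i i' j hi
    · rw [map_sub, map_sum, map_one, sub_eq_zero]
      exact h.isPermMat.col_sum j
    · rw [map_mul]
      exact h.isPermMat.row_mul i j j' hj
    · rw [map_sub, map_sum, map_one, sub_eq_zero]
      exact h.isPermMat.row_sum i
    · exact h.pole i l hl
    · rw [map_pow]
      exact h.nil i l hl
    · rw [map_sub, map_mul, map_one, sub_eq_zero]
      exact h.inv i

variable (k r)

/-- The coordinate ring of the scheme of automorphisms with coordinates bounded by `n`. -/
abbrev CoordRing (n : ℕ) : Type u := MvPolynomial (CoordIndex r) k ⧸ relIdeal k r n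

variable {k r}

theorem isPoint_mk (n : ℕ) :
    IsPoint n fun v => Ideal.Quotient.mk (relIdeal k r n) (MvPolynomial.X v) :=
  (relIdeal_le_ker_iff _).1 (by rw [Ideal.mk_ker])

theorem relIdeal_antitone {n n' : ℕ} (h : n ≤ n') : relIdeal k r n' ≤ relIdeal k r n := by
  have := (relIdeal_le_ker_iff (n := n') (Ideal.Quotient.mk (relIdeal k r n))).2
    ((isPoint_mk n).mono h)
  rwa [Ideal.mk_ker] at this

/-- The transition maps between the coordinate rings. -/
def transition {n n' : ℕ} (h : n ≤ n') : CoordRing k r n' →+* CoordRing k r n :=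
  Ideal.Quotient.factor (relIdeal_antitone h)

theorem transition_self {n : ℕ} :
    (transition (le_refl n) : CoordRing k r n →+* CoordRing k r n) = RingHom.id _ :=
  Ideal.Quotient.factor_eq

theorem transition_comp {n n' n'' : ℕ} (h : n ≤ n') (h' : n' ≤ n'') :
    (transition h : CoordRing k r n' →+* CoordRing k r n).comp (transition h') =
      transition (h.trans h') :=
  Ideal.Quotient.factor_comp _ _

theorem transition_surjective {n n' : ℕ} (h : n ≤ n') :
    Function.Surjective (transition (k := k) (r := r) h) := Ideal.Quotient.factor_surjective _

theorem isNilpotent_ker_transition {n n' : ℕ} (h : n ≤ n') :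
    IsNilpotent (RingHom.ker (transition (k := k) (r := r) h)) := by
  obtain ⟨I, ⟨N, hN⟩, hI⟩ := (isPoint_mk (k := k) (r := r) n').exists_nilpotent_ideal n
  set f : MvPolynomial (CoordIndex r) k →+* CoordRing k r n' ⧸ I :=
    (Ideal.Quotient.mk I).comp (Ideal.Quotient.mk (relIdeal k r n'))
  have hle : relIdeal k r n ≤ RingHom.ker f := (relIdeal_le_ker_iff f).2 hI
  have hker : RingHom.ker (transition (k := k) (r := r) h) ≤ I := by
    intro c hc
    obtain ⟨p, rfl⟩ := Ideal.Quotient.mk_surjective c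
    have hp : p ∈ relIdeal k r n := Ideal.Quotient.eq_zero_iff_mem.1 hc
    exact Ideal.Quotient.eq_zero_iff_mem.1 (hle hp)
  exact ⟨N, le_bot_iff.1 (le_trans (Ideal.pow_right_mono hker N) (le_of_eq hN))⟩

end CoordRing

/-! ### The approximating schemes -/

section SpecPoints

variable {X Y : Scheme.{u}} {A B : CommRingCat.{u}}

/-- The ring homomorphism `A → H⁰(X, O_X)` which corresponds to a morphism `X → Spec A`. -/
def pointMap (f : X ⟶ Spec A) : A ⟶ Γ(X, ⊤) := (Scheme.ΓSpecIso A).inv ≫ f.appTop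

theorem pointMap_injective {f g : X ⟶ Spec A} (h : pointMap f = pointMap g) : f = g :=
  ext_to_Spec (R := A) h

theorem pointMap_comp_specMap (f : X ⟶ Spec B) (g : A ⟶ B) :
    pointMap (f ≫ Spec.map g) = g ≫ pointMap f := by
  rw [pointMap, pointMap, Scheme.Hom.comp_appTop, ← Category.assoc,
    ← Scheme.ΓSpecIso_inv_naturality, Category.assoc]

theorem pointMap_comp (h : Y ⟶ X) (f : X ⟶ Spec A) : pointMap (h ≫ f) = pointMap f ≫ h.appTop := by
  rw [pointMap, pointMap, Scheme.Hom.comp_appTop, Category.assoc]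

theorem pointMap_toSpecΓ (φ : A ⟶ Γ(X, ⊤)) : pointMap (X.toSpecΓ ≫ Spec.map φ) = φ := by
  rw [pointMap_comp_specMap, pointMap, Scheme.toSpecΓ_appTop, Iso.inv_hom_id, Category.comp_id]

end SpecPoints

section Approx

variable (k : Type u) [Field k]

variable {k} in
/-- The structure map of the ring of global sections of a `k`-scheme. -/
def structureMap (S : Sch k) : k →+* Γ(S.left, ⊤) :=
  (pointMap (A := CommRingCat.of k) S.hom).hom

variable {k} in
theorem isUnit_intCast_of_ringHom [CharZero k] {R : Type u} [CommRing R] (f : k →+* R) (n : ℤ)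
    (hn : n ≠ 0) : IsUnit (n : R) := by
  have := (IsUnit.mk0 (n : k) (Int.cast_ne_zero.2 hn)).map f
  rwa [map_intCast] at this

variable (r : ℕ)

/-- The scheme of automorphisms with coordinates bounded by `n`. -/
def approxObj (n : ℕ) : Sch k :=
  Over.mk (Spec.map (CommRingCat.ofHom (algebraMap k (CoordRing k r n))))

/-- The inclusions between the schemes of automorphisms with bounded coordinates. -/
def approxMap {n n' : ℕ} (h : n ≤ n') : approxObj k r n ⟶ approxObj k r n' :=
  Over.homMk (Spec.map (CommRingCat.ofHom (transition h))) (by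
    refine (Spec.map_comp _ _).symm.trans (congrArg Spec.map ?_)
    ext c
    rfl)

theorem approxMap_self (n : ℕ) : approxMap k r (le_refl n) = 𝟙 _ := by
  refine Over.OverMorphism.ext ?_
  refine Eq.trans (congrArg (fun f => Spec.map (CommRingCat.ofHom f)) transition_self) ?_
  exact Spec.map_id _

theorem approxMap_trans {n n' n'' : ℕ} (h : n ≤ n') (h' : n' ≤ n'') :
    approxMap k r (h.trans h') = approxMap k r h ≫ approxMap k r h' := by
  refine Over.OverMorphism.ext ?_
  refine Eq.trans (congrArg (fun f => Spec.map (CommRingCat.ofHom f))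
    (transition_comp h h').symm) ?_
  exact Spec.map_comp (CommRingCat.ofHom (transition h')) (CommRingCat.ofHom (transition h))

/-- The directed system of the schemes of automorphisms with bounded coordinates. -/
def approx : ULift.{u} ℕ ⥤ Sch k where
  obj n := approxObj k r n.down
  map a := approxMap k r a.le
  map_id n := approxMap_self k r n.down
  map_comp a b := approxMap_trans k r a.le b.le

variable {k r}

theorem isNilpotent_ker_specMap {A B : CommRingCat.{u}} (f : A ⟶ B)
    (hf : IsNilpotent (RingHom.ker f.hom)) : IsNilpotent (Spec.map f).ker := by
  obtain ⟨N, hN⟩ := hf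
  have hle : RingHom.ker (Spec.map f).appTop.hom
      ≤ Ideal.map (Scheme.ΓSpecIso A).inv.hom (RingHom.ker f.hom) := by
    intro y hy
    have h1 : (Scheme.ΓSpecIso A).hom.hom y ∈ RingHom.ker f.hom := by
      have := congrArg (fun g => g.hom y) (Scheme.ΓSpecIso_naturality f)
      simp only [CommRingCat.hom_comp, RingHom.comp_apply] at this
      rw [RingHom.mem_ker, ← this, (show (Spec.map f).appTop.hom y = 0 from hy), map_zero]
    have h2 := Ideal.mem_map_of_mem (Scheme.ΓSpecIso A).inv.hom h1
    have h3 := congrArg (fun g => g.hom y) (Scheme.ΓSpecIso A).hom_inv_id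
    simp only [CommRingCat.hom_comp, RingHom.comp_apply] at h3
    rw [h3] at h2
    exact h2
  have hpow : RingHom.ker (Spec.map f).appTop.hom ^ N = ⊥ := by
    refine le_bot_iff.1 ((Ideal.pow_right_mono hle N).trans ?_)
    rw [← Ideal.map_pow, hN]
    exact (Ideal.map_bot).le
  rw [Scheme.ker_of_isAffine]
  refine ⟨N, Scheme.IdealSheafData.equivOfIsAffine.injective ?_⟩
  rw [map_pow, map_zero]
  refine Eq.trans (congrArg (· ^ N) ?_) hpow
  exact Scheme.IdealSheafData.equivOfIsAffine.apply_symm_apply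
    (RingHom.ker (Spec.map f).appTop.hom)

theorem approx_map {i j : ULift.{u} ℕ} (a : i ⟶ j) :
    IsClosedImmersion ((approx k r).map a).left ∧ IsNilpotent ((approx k r).map a).left.ker :=
  ⟨IsClosedImmersion.spec_of_surjective _ (transition_surjective a.le),
    isNilpotent_ker_specMap _ (isNilpotent_ker_transition a.le)⟩

/-- The map on rings of global sections defined by a point of an approximating scheme. -/
def sectionMap {S : Sch k} {n : ℕ} (f : S ⟶ approxObj k r n) : CoordRing k r n →+* Γ(S.left, ⊤) :=
  (pointMap (A := CommRingCat.of (CoordRing k r n)) f.left).hom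

theorem sectionMap_algebraMap {S : Sch k} {n : ℕ} (f : S ⟶ approxObj k r n) (c : k) :
    sectionMap f (algebraMap k _ c) = structureMap S c := by
  have h := pointMap_comp_specMap (B := CommRingCat.of (CoordRing k r n)) f.left
    (CommRingCat.ofHom (algebraMap k (CoordRing k r n)))
  have h' : f.left ≫ Spec.map (CommRingCat.ofHom (algebraMap k (CoordRing k r n))) = S.hom :=
    Over.w f
  exact congrArg (fun g => g.hom c)
    (h.symm.trans (congrArg (pointMap (A := CommRingCat.of k)) h'))

/-- The coordinates of a point of an approximating scheme. -/
def coords {S : Sch k} {n : ℕ} (f : S ⟶ approxObj k r n) : CoordIndex r → Γ(S.left, ⊤) :=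
  fun v => sectionMap f (Ideal.Quotient.mk _ (MvPolynomial.X v))

theorem isPoint_coords {S : Sch k} {n : ℕ} (f : S ⟶ approxObj k r n) : IsPoint n (coords f) :=
  (isPoint_mk n).map (sectionMap f)

theorem coords_injective {S : Sch k} {n : ℕ} {f g : S ⟶ approxObj k r n}
    (h : coords f = coords g) : f = g := by
  refine Over.OverMorphism.ext (pointMap_injective (A := CommRingCat.of (CoordRing k r n))
    (CommRingCat.hom_ext ?_))
  change sectionMap f = sectionMap g
  refine Ideal.Quotient.ringHom_ext (MvPolynomial.ringHom_ext (fun c => ?_) fun v => congrFun h v)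
  exact (sectionMap_algebraMap f c).trans (sectionMap_algebraMap g c).symm

theorem exists_coords_eq {S : Sch k} {n : ℕ} {x : CoordIndex r → Γ(S.left, ⊤)} (hx : IsPoint n x) :
    ∃ f : S ⟶ approxObj k r n, coords f = x := by
  have hle : relIdeal k r n ≤ RingHom.ker (MvPolynomial.eval₂Hom (structureMap S) x) := by
    rw [relIdeal_le_ker_iff]
    simpa using hx
  set φ : CoordRing k r n →+* Γ(S.left, ⊤) := Ideal.Quotient.lift _ _ fun p hp => hle hp with hφ
  have hk : φ.comp (algebraMap k (CoordRing k r n)) = structureMap S := by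
    ext c
    change MvPolynomial.eval₂Hom (structureMap S) x (MvPolynomial.C c) = _
    simp
  let g : S.left ⟶ Spec (CommRingCat.of (CoordRing k r n)) :=
    S.left.toSpecΓ ≫ Spec.map (CommRingCat.ofHom φ)
  have hsec : pointMap g = CommRingCat.ofHom φ := pointMap_toSpecΓ _
  have hg : g ≫ Spec.map (CommRingCat.ofHom (algebraMap k (CoordRing k r n))) = S.hom := by
    refine pointMap_injective (A := CommRingCat.of k) ?_
    rw [pointMap_comp_specMap, hsec, ← CommRingCat.ofHom_comp, hk]
    rfl
  refine ⟨Over.homMk g hg, ?_⟩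
  funext v
  refine (congrArg (fun h => h.hom (Ideal.Quotient.mk _ (MvPolynomial.X v))) hsec).trans ?_
  change MvPolynomial.eval₂Hom (structureMap S) x (MvPolynomial.X v) = _
  simp

theorem coords_comp {S T : Sch k} {n : ℕ} (g : T ⟶ S) (f : S ⟶ approxObj k r n) :
    coords (g ≫ f) = g.left.appTop.hom ∘ coords f :=
  funext fun v => congrArg (fun h => h.hom (Ideal.Quotient.mk _ (MvPolynomial.X v)))
    (pointMap_comp (A := CommRingCat.of (CoordRing k r n)) g.left f.left)

theorem coords_comp_approxMap {S : Sch k} {n n' : ℕ} (h : n ≤ n') (f : S ⟶ approxObj k r n) :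
    coords (f ≫ approxMap k r h) = coords f :=
  funext fun v => congrArg (fun h => h.hom (Ideal.Quotient.mk _ (MvPolynomial.X v)))
    (pointMap_comp_specMap (B := CommRingCat.of (CoordRing k r n)) f.left
      (CommRingCat.ofHom (transition h)))

end Approx

/-! ### The functor of automorphisms as a direct limit -/

section Colimit

variable {k : Type u} [Field k] {r : ℕ}

/-- The automorphism with the coordinates of a given point of an approximating scheme. -/
def autOfPoint {S : Sch k} {n : ℕ} (f : S ⟶ approxObj k r n) : contAut r Γ(S.left, ⊤) :=
  (isPoint_coords f).exists_hasCoords.choose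

theorem hasCoords_autOfPoint {S : Sch k} {n : ℕ} (f : S ⟶ approxObj k r n) :
    HasCoords (autOfPoint f) (coords f) :=
  (isPoint_coords f).exists_hasCoords.choose_spec

variable [CharZero k]

theorem isUnit_intCast_sections (S : Sch k) (n : ℤ) (hn : n ≠ 0) : IsUnit (n : Γ(S.left, ⊤)) :=
  isUnit_intCast_of_ringHom (structureMap S) n hn

theorem autOfPoint_comp {S T : Sch k} {n : ℕ} (g : T ⟶ S) (f : S ⟶ approxObj k r n) :
    autOfPoint (g ≫ f) = baseChange r g.left.appTop.hom (autOfPoint f) := by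
  have h := hasCoords_autOfPoint (g ≫ f)
  rw [coords_comp] at h
  exact h.eq (isUnit_intCast_sections T) ((hasCoords_autOfPoint f).map _)

theorem autOfPoint_comp_approxMap {S : Sch k} {n n' : ℕ} (h : n ≤ n') (f : S ⟶ approxObj k r n) :
    autOfPoint (f ≫ approxMap k r h) = autOfPoint f := by
  have h := hasCoords_autOfPoint (f ≫ approxMap k r h)
  rw [coords_comp_approxMap] at h
  exact h.eq (isUnit_intCast_sections S) (hasCoords_autOfPoint f)

variable (k r)

/-- The maps from the approximating schemes to the functor of automorphisms. -/
def approxCocone : approx k r ⋙ yoneda ⟶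
    (Functor.const _).obj (autV k r ⋙ forget GrpCat.{u}) where
  app n :=
    { app := fun S => ↾fun f => autOfPoint (S := S.unop) (n := n.down) f
      naturality := fun S T g => by
        ext f
        exact autOfPoint_comp g.unop f }
  naturality n n' a := by
    ext S f
    exact autOfPoint_comp_approxMap a.le f

/-- At a fixed scheme, every automorphism comes from some approximating scheme, and points with the
same automorphism have the same coordinates, so they agree in a common approximating scheme. -/
theorem isColimit_approxCocone : Nonempty (IsColimit (Cocone.mk _ (approxCocone k r))) := by
  refine ⟨evaluationJointlyReflectsColimits _ fun S => ?_⟩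
  refine Types.FilteredColimit.isColimitOf _ _ (fun φ => ?_) fun i j f g h => ?_
  · obtain ⟨n, x, hx, hφ⟩ := exists_isPoint_hasCoords (isUnit_intCast_sections S.unop) φ
    obtain ⟨f, hf⟩ := exists_coords_eq hx
    refine ⟨⟨n⟩, f, HasCoords.eq (isUnit_intCast_sections S.unop) hφ ?_⟩
    rw [← hf]
    exact hasCoords_autOfPoint f
  · have hc : coords (S := S.unop) (n := i.down) f = coords (S := S.unop) (n := j.down) g :=
      (hasCoords_autOfPoint f).unique
        ((show autOfPoint (S := S.unop) f = autOfPoint (S := S.unop) g from h) ▸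
          hasCoords_autOfPoint g)
    refine ⟨⟨max i.down j.down⟩, homOfLE (le_max_left i.down j.down),
      homOfLE (le_max_right i.down j.down), ?_⟩
    refine coords_injective (S := S.unop) ?_
    exact (coords_comp_approxMap _ _).trans (hc.trans (coords_comp_approxMap _ _).symm)

theorem isFormalGroupScheme_autV : IsFormalGroupScheme (autV k r) :=
  ⟨ULift.{u} ℕ, inferInstance,
    ⟨fun i j => ⟨⟨max i.down j.down⟩, le_max_left i.down j.down, le_max_right i.down j.down⟩⟩,
    inferInstance, approx k r, fun _ _ => approx_map, approxCocone k r,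
    isColimit_approxCocone k r⟩

/-- The morphism of functors which records the permutation of the factors. -/
def permNat : autV k r ⟶ symmGroup k r where
  app S := GrpCat.ofHom (permHom (isUnit_intCast_sections S.unop))
  naturality S T f := by
    ext φ
    exact permFun_baseChange (isUnit_intCast_sections S.unop) (isUnit_intCast_sections T.unop)
      f.unop.left φ

/-- The section of `permNat` defined by the automorphisms which permute the factors. -/
def permSection : symmGroup k r ⟶ autV k r where
  app S := GrpCat.ofHom (permAutHom (isUnit_intCast_sections S.unop))
  naturality S T f := by
    ext σ
    exact permAutHom_comap (isUnit_intCast_sections S.unop) (isUnit_intCast_sections T.unop)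
      f.unop.left σ

end Colimit

end

end Virasoro

theorem mainTheorem11 (k : Type u) [Field k] [IsAlgClosed k] [CharZero k] (r : ℕ) :
    (∃ p : Virasoro.autV k r ⟶ Virasoro.symmGroup k r,
      -- `p` records the permutation of the factors: `φ(s) (I_i) = I_{p(φ)(s)(i)}`
      (∀ (S : Virasoro.Sch k) (φ : (Virasoro.autV k r).obj (op S)) (s : S.left) (i : Fin r),
        Ideal.map (Virasoro.evalAt S φ s).1
            (Virasoro.factorIdeal r (S.left.residueField s) i) =
          Virasoro.factorIdeal r (S.left.residueField s)
            (Virasoro.permAt S ((p.app (op S)).hom φ) s i)) ∧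
      -- the sequence `0 → G × ⋯ × G → Aut(V) → S_r → 0` is exact
      (∀ S : (Virasoro.Sch k)ᵒᵖ,
        Function.Injective ((Virasoro.inclG k r).app S).hom ∧
        ((Virasoro.inclG k r).app S).hom.range = (p.app S).hom.ker ∧
        Function.Surjective (p.app S).hom) ∧
      -- it splits
      ∃ t : Virasoro.symmGroup k r ⟶ Virasoro.autV k r, t ≫ p = 𝟙 _) ∧
    Virasoro.IsFormalGroupScheme (Virasoro.autV k r) := by
  refine ⟨⟨Virasoro.permNat k r, fun S φ s i => ?_, fun S =>
    ⟨Virasoro.diagHom_injective, Virasoro.range_diagHom _, fun σ =>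
      ⟨_, Virasoro.permFun_permAutHom (Virasoro.isUnit_intCast_sections S.unop) σ⟩⟩,
    Virasoro.permSection k r, ?_⟩,
    Virasoro.isFormalGroupScheme_autV k r⟩
  · refine Virasoro.map_factorIdeal (Virasoro.isUnit_intCast_of_ringHom
      ((S.left.Γevaluation s).hom.comp (Virasoro.structureMap S))) _ _ _ fun j => ?_
    refine (Virasoro.permCoord_baseChange _ _ _ _).trans ?_
    exact Virasoro.hasPermValues_permFun (Virasoro.isUnit_intCast_sections S) φ s i j
  · ext S σ
    exact Virasoro.permFun_permAutHom (Virasoro.isUnit_intCast_sections S.unop) σ
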